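/- Let $a,b\in\mathbb R$ with $b\neq0$, and fix a parity $s\in\{1,-1\}$. For $T>0$ and integers $n\ge 1$ with $(-1)^n=s$, let $x_n$ denote the solution of $$x''+(a+(-1)^nb)\,x+x^3=0,\qquad x(0)=A_n>0,\quad x'(0)=0,$$ with strictly positive Hamiltonian $\tfrac12(x')^2+\tfrac12(a+(-1)^nb)x^2+\tfrac14x^4$ and minimal period $p=2T/n$ (whenever it exists), and put $\varepsilon:=A_n^{-2}$. Then $x_n$ is also a periodic solution of the delayed Duffing equation $x''+ax+b\,x(t-T)+x^3=0$. Consider the linearization $$y''(t)+a\,y(t)+b\,y(t-T)+3x_n(t)^2\,y(t)=0 ,$$ as a first order system for $(y,y')$ with phase space $C^0([-T,0],\mathbb C^2)$. The nonzero eigenvalues of its time-$p$ map are the Floquet multipliers, and the nonzero eigenvalues $\mu$ of its time-$p/2$ map are the half-period Floquet multipliers, of $x_n$; the trivial ones are $1$ and $-1$, respectively. Call $x_n$ linearly stable if the Floquet multiplier $1$ is algebraically simple and all other Floquet multipliers lie in the open unit disk, and linearly unstable if some Floquet multiplier has modulus greater than $1$. Theorem 5.1. There is a function $\sigma=\sigma(r,T)\in\mathbb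 R$ of two real variables (depending only on $a,b,s$) with $$\sigma_*(T):=\sigma(0,T)=1-\tfrac13\,s\,b\,T^2+O(T^3)\qquad (T\to0),$$ such that for every bound $R>1$ there are $T_0>0$ and $\delta_0>0$ for which, with $\varepsilon_0:=\delta_0T_0^2$, the function $\sigma$ is real analytic on $\{|r|<\sqrt{\varepsilon_0}\}\times\{|T|<T_0\}$, and the following holds for all $0<T<T_0$, all $n\geq1$ with $(-1)^n=s$, and all $x_n$ as above with $\varepsilon=A_n^{-2}<\varepsilon_0$: (i) besides the trivial half-period Floquet multiplier $-1$, there is exactly one half-period Floquet multiplier $\mu\in\mathbb C$ of $x_n$ with $|(-\mu)^{-n}|\le R$, and this nontrivial multiplier satisfies $(-\mu)^{-n}=\sigma(\sqrt\varepsilon,T)$; (ii) $x_n$ is linearly stable if and only if $(-1)^nb<0$, and linearly unstable if and only if $(-1)^nb>0$. -/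

import Mathlib

open Set Filter Topology Asymptotics

/-- `x` solves the Duffing oscillator `x'' + α x + x³ = 0` with initial data `x(0) = A > 0`,
`x'(0) = 0`, with strictly positive Hamiltonian `(x')²/2 + α x²/2 + x⁴/4`, and with minimal
period `p > 0`. -/
structure IsDuffingOrbit (α A p : ℝ) (x : ℝ → ℝ) : Prop where
  hasDerivAt : ∀ t, HasDerivAt x (deriv x t) t
  hasDerivAt_deriv : ∀ t, HasDerivAt (deriv x) (-α * x t - x t ^ 3) t
  amplitude_pos : 0 < A
  initial : x 0 = A
  initial_deriv : deriv x 0 = 0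
  energy_pos : ∀ t, 0 < deriv x t ^ 2 / 2 + α * x t ^ 2 / 2 + x t ^ 4 / 4
  period_pos : 0 < p
  periodic : Function.Periodic x p
  period_minimal : ∀ q, 0 < q → Function.Periodic x q → p ≤ q

/-- The (complexified) phase space `C⁰([-T,0], ℂ²)` of histories of `(y, y')`. -/
abbrev PhaseSpace (T : ℝ) : Type := C(Icc (-T) (0 : ℝ), ℂ × ℂ)

/-- `z = (y, y')` solves, on `[0, ∞)` and with history on `[-T, 0]`, the linearization
`y''(t) + a y(t) + b y(t - T) + 3 x(t)² y(t) = 0` of the delayed Duffing equation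
`x'' + a x + b x(t - T) + x³ = 0` along `x`, written as a first order system.
The derivative at `t = 0` is one-sided. -/
structure IsLinearizedSolution (a b T : ℝ) (x : ℝ → ℝ) (z : ℝ → ℂ × ℂ) : Prop where
  continuousOn : ContinuousOn z (Ici (-T))
  hasDerivWithinAt : ∀ t, 0 ≤ t → HasDerivWithinAt z
    ((z t).2, -((a : ℂ) + 3 * (x t : ℂ) ^ 2) * (z t).1 - (b : ℂ) * (z (t - T)).1) (Ici 0) t

/-- The graph of the time-`τ` map `Π : z₀ ↦ z_τ`, `z_t(θ) = z(t + θ)`, of the linearized delay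
equation: the solution with initial history `φ` has the history `ψ` at time `τ`. -/
def EvolvesTo (a b T : ℝ) (x : ℝ → ℝ) (τ : ℝ) (φ ψ : PhaseSpace T) : Prop :=
  ∃ z : ℝ → ℂ × ℂ, IsLinearizedSolution a b T x z ∧
    (∀ θ : Icc (-T) (0 : ℝ), z θ = φ θ) ∧ (∀ θ : Icc (-T) (0 : ℝ), z (τ + θ) = ψ θ)

/-- Nonzero eigenvalues of the time-`τ` map. These are the Floquet multipliers if `τ` is the period
of `x`, and the half-period Floquet multipliers if `τ` is the half-period. -/
def IsMultiplier (a b T : ℝ) (x : ℝ → ℝ) (τ : ℝ) (μ : ℂ) : Prop :=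
  μ ≠ 0 ∧ ∃ φ : PhaseSpace T, φ ≠ 0 ∧ EvolvesTo a b T x τ φ (μ • φ)

/-- `ψ` lies in the kernel of `(Π - μ)^k`, where `Π` is the time-`τ` map. -/
def InGeneralizedKernel (a b T : ℝ) (x : ℝ → ℝ) (τ : ℝ) (μ : ℂ) : ℕ → PhaseSpace T → Prop
  | 0, ψ => ψ = 0
  | k + 1, ψ => ∃ χ : PhaseSpace T, EvolvesTo a b T x τ ψ (μ • ψ + χ) ∧
      InGeneralizedKernel a b T x τ μ k χ

/-- `μ` is an algebraically simple eigenvalue of the time-`τ` map: its generalized eigenspace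
is one-dimensional. -/
def IsAlgebraicallySimple (a b T : ℝ) (x : ℝ → ℝ) (τ : ℝ) (μ : ℂ) : Prop :=
  ∃ φ : PhaseSpace T, φ ≠ 0 ∧ ∀ ψ : PhaseSpace T,
    (∃ k, InGeneralizedKernel a b T x τ μ k ψ) ↔ ∃ c : ℂ, ψ = c • φ

/-- Linear stability of the `p`-periodic solution `x` of the delayed Duffing equation: the trivial
Floquet multiplier `1` is algebraically simple and all others lie in the open unit disk. -/
def LinearlyStable (a b T p : ℝ) (x : ℝ → ℝ) : Prop :=
  IsAlgebraicallySimple a b T x p 1 ∧ ∀ μ : ℂ, IsMultiplier a b T x p μ → μ ≠ 1 → ‖μ‖ < 1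

/-- Linear instability: some Floquet multiplier lies strictly outside the unit circle. -/
def LinearlyUnstable (a b T p : ℝ) (x : ℝ → ℝ) : Prop :=
  ∃ μ : ℂ, IsMultiplier a b T x p μ ∧ 1 < ‖μ‖

/-! Put r = 1/A = √ε, α = a + (-1)^n b, β = (-1)^n b and k = r²α. The rescaled orbit solves u'' + k
u + u³ = 0 with u(0) = 1 and has half period q(k), so that T = n r q(k). If a solution y of the
linearization is multiplied by -ν over each half period, then y(t - T) = (-ν)^(-n) y(t), and the
delay equation becomes a Hill equation whose spectral parameter is shifted by η = r²β(σ - 1), with σ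
= ν^(-n). Its half-period monodromy has determinant 1. At η = 0 the velocity of the orbit is an
antiperiodic solution, so the trace is -2 there. Hence the characteristic equation is ν + 1/ν = 2 +
η G(k, η), where G is analytic near the origin and G(0, 0) = -q(0)²/3
(`exists_analytic_discriminant`).

Write ν = exp(-θ), l = nθ and σ = exp(l). Both sides of ν + 1/ν - 2 = η G vanish at the trivial root
l = 0. Division by r² l removes it, and because T = n r q(k) the integer n disappears: m = l/T²
satisfies a fixed point equation that is analytic in (r, T, m) and whose right-hand side at r = T =
0 is the constant -β/3. The implicit function theorem gives m = M(r, T), so σ = exp(T² M(r, T)) = 1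
- βT²/3 + O(T³) at r = 0. Conversely |σ| ≤ R forces θ = O(r) and l = O(T) uniformly in n, so no
other root exists in that disk (`exists_multiplier_function`). Complex conjugation permutes the
multipliers, so the single nontrivial one is real.

For stability, Re M has the sign of -β, which decides whether |ν| < 1 or |ν| > 1. A half-period
multiplier of modulus at least 1 has |σ| ≤ 1 ≤ R and is therefore already on the list. Floquet
multipliers are squares of half-period multipliers. Algebraic simplicity of 1 follows from Green's
identity with the velocity x', which excludes Jordan chains
(`IsDuffingOrbit.isAlgebraicallySimple`). -/

open scoped ContDiff

/-! ### Planar linear systems on [0, π] with analytic dependence on the coefficients. -/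

/-- Continuous complex functions on `[0, π]`. -/
abbrev HalfTurn : Type := C(Icc (0 : ℝ) Real.pi, ℂ)

/-- The extension of a function on `[0, π]` to the line, constant outside the interval. -/
noncomputable def HalfTurn.ext (f : HalfTurn) (φ : ℝ) : ℂ := f (projIcc 0 Real.pi Real.pi_pos.le φ)

namespace HalfTurn

lemma continuous_ext (f : HalfTurn) : Continuous f.ext :=
  f.continuous.comp continuous_projIcc

lemma ext_of_mem (f : HalfTurn) {φ : ℝ} (h : φ ∈ Icc 0 Real.pi) : f.ext φ = f ⟨φ, h⟩ := by
  rw [ext, projIcc_of_mem]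

lemma norm_ext_le (f : HalfTurn) (φ : ℝ) : ‖f.ext φ‖ ≤ ‖f‖ := f.norm_coe_le_norm _

@[simp] lemma ext_add (f g : HalfTurn) (φ : ℝ) : (f + g).ext φ = f.ext φ + g.ext φ := rfl
@[simp] lemma ext_mul (f g : HalfTurn) (φ : ℝ) : (f * g).ext φ = f.ext φ * g.ext φ := rfl
@[simp] lemma ext_smul (c : ℂ) (f : HalfTurn) (φ : ℝ) : (c • f).ext φ = c * f.ext φ := rfl
@[simp] lemma ext_neg (f : HalfTurn) (φ : ℝ) : (-f).ext φ = -f.ext φ := rfl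
@[simp] lemma ext_one (φ : ℝ) : (1 : HalfTurn).ext φ = 1 := rfl

/-- The antiderivative vanishing at `0`, as a continuous linear operator. -/
noncomputable def volterra : HalfTurn →L[ℂ] HalfTurn :=
  LinearMap.mkContinuous
    { toFun := fun f => ⟨fun φ => ∫ ψ in (0 : ℝ)..φ, f.ext ψ,
        (intervalIntegral.continuous_primitive
          (fun _ _ => f.continuous_ext.intervalIntegrable _ _) 0).comp continuous_subtype_val⟩
      map_add' := fun f g => by
        ext φ
        simp only [ContinuousMap.coe_mk, ContinuousMap.add_apply, ext_add]
        exact intervalIntegral.integral_add (f.continuous_ext.intervalIntegrable _ _)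
          (g.continuous_ext.intervalIntegrable _ _)
      map_smul' := fun c f => by
        ext φ
        simp }
    Real.pi (fun f => by
      refine (ContinuousMap.norm_le _ (by positivity)).2 fun φ => ?_
      have h := intervalIntegral.norm_integral_le_of_norm_le_const (a := (0 : ℝ)) (b := φ)
        (f := f.ext) (C := ‖f‖) (fun ψ _ => f.norm_ext_le ψ)
      refine h.trans ?_
      have h1 : |(φ : ℝ) - 0| ≤ Real.pi := by
        rw [sub_zero, abs_of_nonneg φ.2.1]; exact φ.2.2
      rw [mul_comm]
      gcongr)

lemma volterra_apply (f : HalfTurn) (φ : Icc (0 : ℝ) Real.pi) :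
    volterra f φ = ∫ ψ in (0 : ℝ)..φ, f.ext ψ := rfl

/-- The integral over `[0, π]`, as a continuous linear functional. -/
noncomputable def integral : HalfTurn →L[ℂ] ℂ :=
  (ContinuousMap.evalCLM ℂ (⟨Real.pi, right_mem_Icc.2 Real.pi_pos.le⟩ : Icc (0 : ℝ) Real.pi)).comp
    volterra

lemma integral_apply (f : HalfTurn) : integral f = ∫ ψ in (0 : ℝ)..Real.pi, f.ext ψ := rfl

/-- The integral operator `(w, v) ↦ (∫ p v, ∫ k w)` of the planar system `w' = p v`, `v' = k w`. -/
noncomputable def systemOp (p k : HalfTurn) : (HalfTurn × HalfTurn) →L[ℂ] (HalfTurn × HalfTurn) :=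
  ((volterra ∘L (ContinuousLinearMap.mul ℂ HalfTurn p)) ∘L ContinuousLinearMap.snd ℂ HalfTurn HalfTurn).prod
  ((volterra ∘L (ContinuousLinearMap.mul ℂ HalfTurn k)) ∘L ContinuousLinearMap.fst ℂ HalfTurn HalfTurn)

lemma systemOp_apply (p k : HalfTurn) (z : HalfTurn × HalfTurn) :
    systemOp p k z = (volterra (p * z.2), volterra (k * z.1)) := rfl

/-- The function `φ ↦ exp (κ φ)` on `[0, π]`. -/
noncomputable def expWeight (κ : ℝ) : HalfTurn := ⟨fun φ => ((Real.exp (κ * φ) : ℝ) : ℂ), by fun_prop⟩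

lemma expWeight_mul_neg (κ : ℝ) : expWeight κ * expWeight (-κ) = 1 := by
  ext φ
  simp [expWeight, ← Complex.exp_add]

lemma expWeight_neg_mul (κ : ℝ) : expWeight (-κ) * expWeight κ = 1 := by
  rw [mul_comm, expWeight_mul_neg]

/-- Integrating exp(κψ) from 0 to φ gains a factor 1/κ. In the exponentially weighted norm the
antiderivative is thus as small as desired. -/
lemma norm_weighted_volterra_le {κ : ℝ} (hκ : 0 < κ) (f : HalfTurn) :
    ‖expWeight (-κ) * volterra (expWeight κ * f)‖ ≤ ‖f‖ / κ := by
  refine (ContinuousMap.norm_le _ (by positivity)).2 fun φ => ?_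
  have h0 : (0 : ℝ) ≤ φ := φ.2.1
  have h : ‖∫ ψ in (0 : ℝ)..φ, (expWeight κ * f).ext ψ‖
      ≤ ∫ ψ in (0 : ℝ)..φ, Real.exp (κ * ψ) * ‖f‖ := by
    refine intervalIntegral.norm_integral_le_of_norm_le h0 ?_
      (Continuous.intervalIntegrable (by fun_prop) _ _)
    refine Filter.Eventually.of_forall fun ψ hψ => ?_
    have hm : ψ ∈ Icc 0 Real.pi := ⟨hψ.1.le, hψ.2.trans φ.2.2⟩
    rw [ext_mul, norm_mul]
    gcongr
    · rw [ext_of_mem _ hm]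
      simp [expWeight, Complex.norm_exp]
    · exact f.norm_ext_le ψ
  have h2 : ∫ ψ in (0 : ℝ)..φ, Real.exp (κ * ψ) * ‖f‖ = (Real.exp (κ * φ) - 1) / κ * ‖f‖ := by
    rw [intervalIntegral.integral_mul_const, intervalIntegral.integral_comp_mul_left _ hκ.ne']
    simp [div_eq_inv_mul]
  rw [ContinuousMap.mul_apply, norm_mul, volterra_apply]
  have h3 : ‖expWeight (-κ) φ‖ = Real.exp (-(κ * φ)) := by
    simp [expWeight, Complex.norm_exp]
  rw [h3]
  calc _ ≤ Real.exp (-(κ * φ)) * ((Real.exp (κ * φ) - 1) / κ * ‖f‖) := by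
        rw [← h2]; gcongr
    _ = (1 - Real.exp (-(κ * φ))) * (‖f‖ / κ) := by
        have : Real.exp (-(κ * φ)) * Real.exp (κ * φ) = 1 := by rw [← Real.exp_add]; simp
        linear_combination (‖f‖ / κ) * this
    _ ≤ 1 * (‖f‖ / κ) := by
        gcongr
        linarith [Real.exp_pos (-(κ * φ))]
    _ = _ := one_mul _

/-- Multiplication of both components by a function. -/
noncomputable def diagMul (e : HalfTurn) : (HalfTurn × HalfTurn) →L[ℂ] (HalfTurn × HalfTurn) :=
  (ContinuousLinearMap.mul ℂ HalfTurn e).prodMap (ContinuousLinearMap.mul ℂ HalfTurn e)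

lemma one_sub_eq_conj {A : Type*} [Ring A] (u : Aˣ) (x : A) :
    1 - x = u * (1 - ↑u⁻¹ * x * u) * ↑u⁻¹ := by
  rw [mul_sub, sub_mul]
  simp [mul_assoc]

/-- Conjugation by the weight exp(κφ) makes the operator a strict contraction once κ exceeds ‖p‖ +
‖k‖, so the Neumann series applies without any smallness of the coefficients. -/
lemma isUnit_one_sub_systemOp (p k : HalfTurn) : IsUnit (1 - systemOp p k) := by
  set κ : ℝ := ‖p‖ + ‖k‖ + 1
  have hκ : 0 < κ := by positivity
  have h1 : diagMul (expWeight κ) * diagMul (expWeight (-κ)) = 1 := by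
    refine ContinuousLinearMap.ext fun z => ?_
    obtain ⟨z1, z2⟩ := z
    change (expWeight κ * (expWeight (-κ) * z1), expWeight κ * (expWeight (-κ) * z2)) = (z1, z2)
    simp [← mul_assoc, expWeight_mul_neg]
  have h2 : diagMul (expWeight (-κ)) * diagMul (expWeight κ) = 1 := by
    refine ContinuousLinearMap.ext fun z => ?_
    obtain ⟨z1, z2⟩ := z
    change (expWeight (-κ) * (expWeight κ * z1), expWeight (-κ) * (expWeight κ * z2)) = (z1, z2)
    simp [← mul_assoc, expWeight_neg_mul]
  let U : ((HalfTurn × HalfTurn) →L[ℂ] (HalfTurn × HalfTurn))ˣ :=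
    ⟨diagMul (expWeight κ), diagMul (expWeight (-κ)), h1, h2⟩
  have h3 : ‖(↑U⁻¹ : (HalfTurn × HalfTurn) →L[ℂ] (HalfTurn × HalfTurn)) * systemOp p k * U‖ < 1 := by
    refine lt_of_le_of_lt (ContinuousLinearMap.opNorm_le_bound _ (M := (‖p‖ + ‖k‖) / κ)
      (by positivity) fun z => ?_) ((div_lt_one hκ).2 (by simp [κ]))
    obtain ⟨z1, z2⟩ := z
    change ‖(expWeight (-κ) * volterra (p * (expWeight κ * z2)),
      expWeight (-κ) * volterra (k * (expWeight κ * z1)))‖ ≤ _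
    rw [Prod.norm_mk, mul_left_comm p, mul_left_comm k]
    have hz1 : ‖z1‖ ≤ ‖(z1, z2)‖ := norm_fst_le (z1, z2)
    have hz2 : ‖z2‖ ≤ ‖(z1, z2)‖ := norm_snd_le (z1, z2)
    refine max_le ((norm_weighted_volterra_le hκ _).trans ?_)
      ((norm_weighted_volterra_le hκ _).trans ?_)
    · rw [div_mul_eq_mul_div]
      gcongr
      refine (norm_mul_le _ _).trans ?_
      gcongr
      linarith [norm_nonneg k]
    · rw [div_mul_eq_mul_div]
      gcongr
      refine (norm_mul_le _ _).trans ?_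
      gcongr
      linarith [norm_nonneg p]
  have h4 : IsUnit (1 - (↑U⁻¹ : (HalfTurn × HalfTurn) →L[ℂ] (HalfTurn × HalfTurn)) * systemOp p k * U) :=
    isUnit_one_sub_of_norm_lt_one (R := (HalfTurn × HalfTurn) →L[ℂ] (HalfTurn × HalfTurn)) h3
  have h5 : 1 - systemOp p k =
      U * (1 - (↑U⁻¹ : (HalfTurn × HalfTurn) →L[ℂ] (HalfTurn × HalfTurn)) * systemOp p k * U) * ↑U⁻¹ :=
    one_sub_eq_conj (A := (HalfTurn × HalfTurn) →L[ℂ] (HalfTurn × HalfTurn)) U _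
  rw [h5]
  exact (U.isUnit.mul h4).mul U⁻¹.isUnit

/-- The solution of `w' = p v`, `v' = k w` with `(w, v)(0) = (e₁, e₂)`. -/
noncomputable def solve (e : ℂ × ℂ) (p k : HalfTurn) : HalfTurn × HalfTurn :=
  Ring.inverse (1 - systemOp p k) (e.1 • 1, e.2 • 1)

lemma solve_eq (e : ℂ × ℂ) (p k : HalfTurn) :
    solve e p k = (e.1 • 1, e.2 • 1) + systemOp p k (solve e p k) := by
  have h := congrArg (fun L => L ((e.1 • (1 : HalfTurn), e.2 • (1 : HalfTurn))))
    (Ring.mul_inverse_cancel _ (isUnit_one_sub_systemOp p k))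
  change (1 - systemOp p k) (solve e p k) = (e.1 • 1, e.2 • 1) at h
  rw [← h]
  simp

lemma contDiffAt_systemOp (z : HalfTurn × HalfTurn) :
    ContDiffAt ℂ ω (fun z : HalfTurn × HalfTurn => systemOp z.1 z.2) z := by
  have h : ∀ (L : HalfTurn × HalfTurn →L[ℂ] HalfTurn) (L' : HalfTurn × HalfTurn →L[ℂ] HalfTurn),
      ContDiffAt ℂ ω (fun z => (volterra ∘L (ContinuousLinearMap.mul ℂ HalfTurn (L z))) ∘L L') z := by
    intro L L'
    refine ContDiffAt.clm_comp (ContDiffAt.clm_comp contDiffAt_const ?_) contDiffAt_const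
    fun_prop
  have h1 := h (ContinuousLinearMap.fst ℂ _ _) (ContinuousLinearMap.snd ℂ _ _)
  have h2 := h (ContinuousLinearMap.snd ℂ _ _) (ContinuousLinearMap.fst ℂ _ _)
  have h3 := (ContDiffAt.clm_comp (contDiffAt_const (c := ContinuousLinearMap.inl ℂ HalfTurn HalfTurn)) h1).add
    (ContDiffAt.clm_comp (contDiffAt_const (c := ContinuousLinearMap.inr ℂ HalfTurn HalfTurn)) h2)
  refine h3.congr_of_eventuallyEq (Filter.Eventually.of_forall fun z => ?_)
  refine ContinuousLinearMap.ext fun y => ?_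
  simp [systemOp_apply]

/-- The integral operator is linear in the coefficients and inversion of bounded operators is
analytic. This replaces a theorem on analytic dependence of differential equations on parameters. -/
lemma contDiffAt_solve (e : ℂ × ℂ) (z : HalfTurn × HalfTurn) :
    ContDiffAt ℂ ω (fun z : HalfTurn × HalfTurn => solve e z.1 z.2) z := by
  unfold solve
  refine ContDiffAt.clm_apply ?_ contDiffAt_const
  obtain ⟨u, hu⟩ := isUnit_one_sub_systemOp z.1 z.2
  have h := contDiffAt_ringInverse (n := ω) (R := (HalfTurn × HalfTurn) →L[ℂ] (HalfTurn × HalfTurn)) ℂ u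
  rw [hu] at h
  exact h.comp z (contDiffAt_const.sub (contDiffAt_systemOp z))

lemma hasDerivWithinAt_volterra (f : HalfTurn) {φ : ℝ} (hφ : φ ∈ Icc 0 Real.pi) :
    HasDerivWithinAt (volterra f).ext (f.ext φ) (Icc 0 Real.pi) φ := by
  have h := (intervalIntegral.integral_hasDerivAt_right (f.continuous_ext.intervalIntegrable 0 φ)
    (f.continuous_ext.stronglyMeasurableAtFilter _ _) f.continuous_ext.continuousAt).hasDerivWithinAt
      (s := Icc 0 Real.pi)
  refine h.congr (fun ψ hψ => ?_) ?_
  · rw [ext_of_mem _ hψ, volterra_apply]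
  · rw [ext_of_mem _ hφ, volterra_apply]

lemma hasDerivWithinAt_solve_fst (e : ℂ × ℂ) (p k : HalfTurn) {φ : ℝ} (hφ : φ ∈ Icc 0 Real.pi) :
    HasDerivWithinAt (solve e p k).1.ext (p.ext φ * (solve e p k).2.ext φ) (Icc 0 Real.pi) φ := by
  have h := congrArg Prod.fst (solve_eq e p k)
  have h2 : (solve e p k).1.ext = fun φ => e.1 + (volterra (p * (solve e p k).2)).ext φ := by
    ext φ
    conv_lhs => rw [h]
    simp [systemOp_apply]
  rw [h2]
  simpa using (hasDerivWithinAt_volterra (p * (solve e p k).2) hφ).const_add e.1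

lemma hasDerivWithinAt_solve_snd (e : ℂ × ℂ) (p k : HalfTurn) {φ : ℝ} (hφ : φ ∈ Icc 0 Real.pi) :
    HasDerivWithinAt (solve e p k).2.ext (k.ext φ * (solve e p k).1.ext φ) (Icc 0 Real.pi) φ := by
  have h := congrArg Prod.snd (solve_eq e p k)
  have h2 : (solve e p k).2.ext = fun φ => e.2 + (volterra (k * (solve e p k).1)).ext φ := by
    ext φ
    conv_lhs => rw [h]
    simp [systemOp_apply]
  rw [h2]
  simpa using (hasDerivWithinAt_volterra (k * (solve e p k).1) hφ).const_add e.2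

lemma volterra_ext_zero (f : HalfTurn) : (volterra f).ext 0 = 0 := by
  rw [ext_of_mem _ (left_mem_Icc.2 Real.pi_pos.le), volterra_apply]
  simp

lemma solve_ext_zero (e : ℂ × ℂ) (p k : HalfTurn) :
    (solve e p k).1.ext 0 = e.1 ∧ (solve e p k).2.ext 0 = e.2 := by
  constructor
  · rw [congrArg Prod.fst (solve_eq e p k)]
    simp [systemOp_apply, volterra_ext_zero]
  · rw [congrArg Prod.snd (solve_eq e p k)]
    simp [systemOp_apply, volterra_ext_zero]

end HalfTurn

/-! ### The angle variable and the Hill system. -/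

/-- The speed of the angle `φ` in the parametrization `u = cos φ` of the orbit
of `u'' + k u + u³ = 0` through `u = 1`, `u' = 0`. -/
noncomputable def angleSpeed (k φ : ℝ) : ℝ := √(k + (1 + Real.cos φ ^ 2) / 2)

section AngleSpeed

variable {k : ℝ}

lemma angleSpeed_arg_pos (hk : -(1 / 2) < k) (φ : ℝ) : 0 < k + (1 + Real.cos φ ^ 2) / 2 := by
  nlinarith [sq_nonneg (Real.cos φ)]

lemma angleSpeed_pos (hk : -(1 / 2) < k) (φ : ℝ) : 0 < angleSpeed k φ :=
  Real.sqrt_pos.2 (angleSpeed_arg_pos hk φ)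

lemma angleSpeed_sq (hk : -(1 / 2) < k) (φ : ℝ) :
    angleSpeed k φ ^ 2 = k + (1 + Real.cos φ ^ 2) / 2 :=
  Real.sq_sqrt (angleSpeed_arg_pos hk φ).le

lemma continuous_angleSpeed (k : ℝ) : Continuous (angleSpeed k) := by
  unfold angleSpeed; fun_prop

lemma continuous_inv_angleSpeed (hk : -(1 / 2) < k) : Continuous fun φ => (angleSpeed k φ)⁻¹ :=
  (continuous_angleSpeed k).inv₀ fun φ => (angleSpeed_pos hk φ).ne'

lemma hasDerivAt_angleSpeed (hk : -(1 / 2) < k) (φ : ℝ) :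
    HasDerivAt (angleSpeed k) (-(Real.cos φ * Real.sin φ) / (2 * angleSpeed k φ)) φ := by
  have h1 : HasDerivAt (fun φ => k + (1 + Real.cos φ ^ 2) / 2) (-(Real.cos φ * Real.sin φ)) φ := by
    have := ((((Real.hasDerivAt_cos φ).pow 2).const_add 1).div_const 2).const_add k
    refine this.congr_deriv ?_
    norm_num
    ring
  exact h1.sqrt (angleSpeed_arg_pos hk φ).ne'

lemma angleSpeed_periodic (k : ℝ) : Function.Periodic (angleSpeed k) Real.pi := by
  intro φ
  simp [angleSpeed, Real.cos_add_pi]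

end AngleSpeed

/-- `(w, v)` solves on `D` the Hill system `w' = v / P`, `v' = -(k + η + 3 cos²) w / P`, `P` being
the angle speed: this is `w'' + (k + η + 3u²) w = 0` along `u'' + k u + u³ = 0` in the angle. -/
structure HillSolution (k : ℝ) (η : ℂ) (D : Set ℝ) (w v : ℝ → ℂ) : Prop where
  fst : ∀ φ ∈ D, HasDerivWithinAt w (((angleSpeed k φ)⁻¹ : ℝ) * v φ) D φ
  snd : ∀ φ ∈ D, HasDerivWithinAt v
    (-(k + η + 3 * (Real.cos φ : ℂ) ^ 2) * ((angleSpeed k φ)⁻¹ : ℝ) * w φ) D φ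

/-- Solutions of a planar linear system `w' = p v`, `v' = q w` with vanishing initial data vanish. -/
lemma planar_linear_eq_zero {L : ℝ} {p q w v : ℝ → ℂ} (hp : ContinuousOn p (Icc 0 L))
    (hq : ContinuousOn q (Icc 0 L))
    (hw : ∀ t ∈ Icc 0 L, HasDerivWithinAt w (p t * v t) (Icc 0 L) t)
    (hv : ∀ t ∈ Icc 0 L, HasDerivWithinAt v (q t * w t) (Icc 0 L) t)
    (hw0 : w 0 = 0) (hv0 : v 0 = 0) : ∀ t ∈ Icc 0 L, w t = 0 ∧ v t = 0 := by
  obtain ⟨C₁, hC₁⟩ := isCompact_Icc.exists_bound_of_continuousOn hp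
  obtain ⟨C₂, hC₂⟩ := isCompact_Icc.exists_bound_of_continuousOn hq
  set K : NNReal := Real.toNNReal (max C₁ C₂)
  have hK : max C₁ C₂ ≤ K := Real.le_coe_toNNReal _
  have key := ODE_solution_unique_of_mem_Icc_right (E := ℂ × ℂ) (K := K) (s := fun _ => univ)
    (v := fun t z => (p t * z.2, q t * z.1)) (f := fun t => (w t, v t)) (g := fun _ => 0)
    (a := 0) (b := L) (fun t ht => ?_) (fun t ht => ?_) (fun t ht => ?_) (fun _ _ => mem_univ _)
    continuousOn_const (fun t ht => ?_) (fun _ _ => mem_univ _) ?_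
  · intro t ht
    have h := key ht
    simpa using h
  · refine (LipschitzWith.of_dist_le_mul fun x y => ?_).lipschitzOnWith
    have ht' := Ico_subset_Icc_self ht
    rw [dist_eq_norm, dist_eq_norm, Prod.mk_sub_mk, ← mul_sub, ← mul_sub, Prod.norm_mk]
    refine max_le ?_ ?_
    · rw [norm_mul]
      gcongr
      · exact (hC₁ t ht').trans ((le_max_left _ _).trans hK)
      · exact norm_snd_le (x - y)
    · rw [norm_mul]
      gcongr
      · exact (hC₂ t ht').trans ((le_max_right _ _).trans hK)
      · exact norm_fst_le (x - y)
  · exact (hw t ht).continuousWithinAt.prodMk (hv t ht).continuousWithinAt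
  · have hm : Icc 0 L ∈ 𝓝[≥] t := Icc_mem_nhdsGE_of_mem ht
    exact ((hw t (Ico_subset_Icc_self ht)).prodMk (hv t (Ico_subset_Icc_self ht))).mono_of_mem_nhdsWithin hm
  · exact (hasDerivWithinAt_const t (Ici t) (0 : ℂ × ℂ)).congr_deriv (by simp; rfl)
  · simp [hw0, hv0]

namespace HillSolution

variable {k : ℝ} {η η' : ℂ} {D : Set ℝ} {w v w' v' : ℝ → ℂ}

lemma add (h : HillSolution k η D w v) (h' : HillSolution k η D w' v') :
    HillSolution k η D (fun φ => w φ + w' φ) (fun φ => v φ + v' φ) := by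
  refine ⟨fun φ hφ => ?_, fun φ hφ => ?_⟩
  · exact ((h.fst φ hφ).add (h'.fst φ hφ)).congr_deriv (by ring)
  · exact ((h.snd φ hφ).add (h'.snd φ hφ)).congr_deriv (by ring)

lemma const_mul (h : HillSolution k η D w v) (c : ℂ) :
    HillSolution k η D (fun φ => c * w φ) (fun φ => c * v φ) := by
  refine ⟨fun φ hφ => ?_, fun φ hφ => ?_⟩
  · exact ((h.fst φ hφ).const_mul c).congr_deriv (by ring)
  · exact ((h.snd φ hφ).const_mul c).congr_deriv (by ring)

lemma eq_zero (hk : -(1 / 2) < k) {L : ℝ} (h : HillSolution k η (Icc 0 L) w v)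
    (hw : w 0 = 0) (hv : v 0 = 0) : ∀ φ ∈ Icc 0 L, w φ = 0 ∧ v φ = 0 := by
  have hc : Continuous fun φ => (((angleSpeed k φ)⁻¹ : ℝ) : ℂ) :=
    Complex.continuous_ofReal.comp (continuous_inv_angleSpeed hk)
  refine planar_linear_eq_zero hc.continuousOn (Continuous.continuousOn ?_) h.fst h.snd hw hv
  exact Continuous.mul (by fun_prop) hc

lemma eq_of_initial (hk : -(1 / 2) < k) {L : ℝ} (h : HillSolution k η (Icc 0 L) w v)
    (h' : HillSolution k η (Icc 0 L) w' v') (hw : w 0 = w' 0) (hv : v 0 = v' 0) :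
    ∀ φ ∈ Icc 0 L, w φ = w' φ ∧ v φ = v' φ := by
  intro φ hφ
  have := (h.add (h'.const_mul (-1))).eq_zero hk (by simp [hw]) (by simp [hv]) φ hφ
  constructor
  · linear_combination this.1
  · linear_combination this.2

/-- Green's identity for two solutions with different parameters. -/
lemma wronskian (hk : -(1 / 2) < k) (h : HillSolution k η (Icc 0 Real.pi) w v)
    (h' : HillSolution k η' (Icc 0 Real.pi) w' v') :
    (w Real.pi * v' Real.pi - v Real.pi * w' Real.pi) - (w 0 * v' 0 - v 0 * w' 0) =
      (η - η') * ∫ φ in (0 : ℝ)..Real.pi, ((angleSpeed k φ)⁻¹ : ℝ) * (w φ * w' φ) := by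
  have hc : Continuous fun φ => (((angleSpeed k φ)⁻¹ : ℝ) : ℂ) :=
    Complex.continuous_ofReal.comp (continuous_inv_angleSpeed hk)
  have hw : ContinuousOn w (Icc 0 Real.pi) := fun φ hφ => (h.fst φ hφ).continuousWithinAt
  have hw' : ContinuousOn w' (Icc 0 Real.pi) := fun φ hφ => (h'.fst φ hφ).continuousWithinAt
  have hv : ContinuousOn v (Icc 0 Real.pi) := fun φ hφ => (h.snd φ hφ).continuousWithinAt
  have hv' : ContinuousOn v' (Icc 0 Real.pi) := fun φ hφ => (h'.snd φ hφ).continuousWithinAt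
  rw [← intervalIntegral.integral_const_mul]
  refine (intervalIntegral.integral_eq_sub_of_hasDerivAt_of_le Real.pi_pos.le
    (f := fun φ => w φ * v' φ - v φ * w' φ)
    ((hw.mul hv').sub (hv.mul hw')) (fun φ hφ => ?_) ?_).symm
  · have hm := Icc_mem_nhds hφ.1 hφ.2
    have hi := Ioo_subset_Icc_self hφ
    have := (((h.fst φ hi).hasDerivAt hm).mul ((h'.snd φ hi).hasDerivAt hm)).sub
      (((h.snd φ hi).hasDerivAt hm).mul ((h'.fst φ hi).hasDerivAt hm))
    refine this.congr_deriv ?_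
    ring
  · refine ContinuousOn.intervalIntegrable ?_
    rw [uIcc_of_le Real.pi_pos.le]
    exact continuousOn_const.mul (hc.continuousOn.mul (hw.mul hw'))

end HillSolution

/-! ### Analytic continuation of the reciprocal angle speed in k. -/

namespace HalfTurn

/-- `cos` on `[0, π]`. -/
noncomputable def cosine : HalfTurn := ⟨fun φ => ((Real.cos φ : ℝ) : ℂ), by fun_prop⟩

/-- The angle speed on `[0, π]`. -/
noncomputable def speed (k : ℝ) : HalfTurn :=
  ⟨fun φ => ((angleSpeed k φ : ℝ) : ℂ),
    Complex.continuous_ofReal.comp ((continuous_angleSpeed k).comp continuous_subtype_val)⟩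

lemma isUnit_speed_zero : IsUnit (speed 0) := by
  rw [ContinuousMap.isUnit_iff_forall_ne_zero]
  intro φ
  exact Complex.ofReal_ne_zero.2 (angleSpeed_pos (by norm_num) _).ne'

/-- The reciprocal of the angle speed extends analytically to complex parameters near `0`. -/
lemma exists_analytic_inv_speed : ∃ g : ℂ → HalfTurn, ContDiffAt ℂ ω g 0 ∧
    ∀ᶠ k : ℝ in 𝓝 0, ∀ φ ∈ Icc 0 Real.pi, (g k).ext φ = (((angleSpeed k φ)⁻¹ : ℝ) : ℂ) := by
  -- The speed is obtained as the root of Q² = k + P₀², with P₀ the speed at k = 0. The implicit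
  -- function theorem in the Banach algebra of continuous functions yields a branch that is analytic
  -- in complex k.
  let f : ℂ × HalfTurn → HalfTurn := fun z => z.2 * z.2 - z.1 • 1
  have hf : ContDiffAt ℂ ω f (0, speed 0) := by
    have : ContDiff ℂ ω f := by
      refine (contDiff_snd.mul contDiff_snd).sub (contDiff_fst.smul contDiff_const)
    exact this.contDiffAt
  have hinv : (fderiv ℂ f (0, speed 0) ∘L .inr ℂ ℂ HalfTurn).IsInvertible := by
    have h1 : fderiv ℂ f (0, speed 0) ∘L .inr ℂ ℂ HalfTurn =
        fderiv ℂ (fun x : HalfTurn => x * x) (speed 0) := by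
      have h2 : HasFDerivAt (fun x : HalfTurn => ((0 : ℂ), x)) (.inr ℂ ℂ HalfTurn) (speed 0) :=
        hasFDerivAt_prodMk_right (0 : ℂ) (speed 0)
      have h3 := (HasFDerivAt.comp (speed 0) (g := f)
        (hf.differentiableAt (by simp)).hasFDerivAt h2).fderiv
      rw [← h3]
      congr 1
      ext x : 1
      refine ContinuousMap.ext fun φ => ?_
      change x φ * x φ - (0 : ℂ) * 1 = x φ * x φ
      ring
    obtain ⟨u, hu⟩ := isUnit_speed_zero
    -- The derivative is multiplication by 2P₀, which is invertible because P₀ has no zeros; the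
    -- inverse supplied is multiplication by 1/(2P₀).
    have h4 : HasFDerivAt (fun x : HalfTurn => x * x)
        (speed 0 • ContinuousLinearMap.id ℂ HalfTurn + MulOpposite.op (speed 0) • ContinuousLinearMap.id ℂ HalfTurn) (speed 0) :=
      (hasFDerivAt_id (speed 0)).mul' (hasFDerivAt_id (speed 0))
    rw [h1, h4.fderiv]
    refine ⟨ContinuousLinearEquiv.equivOfInverse (speed 0 • ContinuousLinearMap.id ℂ HalfTurn +
        MulOpposite.op (speed 0) • ContinuousLinearMap.id ℂ HalfTurn)
      ((2⁻¹ : ℂ) • ContinuousLinearMap.mul ℂ HalfTurn (↑u⁻¹ : HalfTurn)) ?_ ?_, rfl⟩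
    · intro x
      change (2⁻¹ : ℂ) • ((↑u⁻¹ : HalfTurn) * (speed 0 * x + x * speed 0)) = x
      rw [mul_comm x, ← two_smul ℂ (speed 0 * x), mul_smul_comm, ← hu, ← mul_assoc, Units.inv_mul]
      simp
    · intro x
      change speed 0 * ((2⁻¹ : ℂ) • ((↑u⁻¹ : HalfTurn) * x)) +
        ((2⁻¹ : ℂ) • ((↑u⁻¹ : HalfTurn) * x)) * speed 0 = x
      rw [mul_comm _ (speed 0), ← two_smul ℂ (speed 0 * _), mul_smul_comm, ← hu, ← mul_assoc,
        Units.mul_inv]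
      simp
  set Q := hf.implicitFunction (by simp) hinv with hQ
  have hQ0 : Q 0 = speed 0 := hf.implicitFunction_apply_self (by simp) hinv
  have hQd : ContDiffAt ℂ ω Q 0 := hf.contDiffAt_implicitFunction (by simp) hinv
  have hQe : ∀ᶠ k in 𝓝 (0 : ℂ), f (k, Q k) = f (0, speed 0) :=
    hf.eventually_apply_implicitFunction (by simp) hinv
  refine ⟨fun k => Ring.inverse (Q k), ?_, ?_⟩
  · obtain ⟨u, hu⟩ := isUnit_speed_zero
    have h := contDiffAt_ringInverse (n := ω) (R := HalfTurn) ℂ u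
    rw [hu, ← hQ0] at h
    exact h.comp (0 : ℂ) hQd
  · have ht : Tendsto (fun k : ℝ => (k : ℂ)) (𝓝 0) (𝓝 0) :=
      Complex.continuous_ofReal.tendsto' _ _ (by simp)
    have hnear : ∀ᶠ k in 𝓝 (0 : ℂ), ‖Q k - speed 0‖ < 1 / 2 := by
      have := hQd.continuousAt
      rw [ContinuousAt, hQ0] at this
      simpa [dist_eq_norm] using Metric.tendsto_nhds.1 this (1 / 2) (by norm_num)
    filter_upwards [ht.eventually hQe, ht.eventually hnear,
      Ioi_mem_nhds (show (-(1 / 2) : ℝ) < 0 by norm_num)] with k h1 h2 h3 φ hφ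
    have hval : ∀ φ : Icc (0 : ℝ) Real.pi, Q k φ = (angleSpeed k φ : ℂ) := by
      intro φ
      have e1 : Q k φ * Q k φ - (k : ℂ) = (angleSpeed 0 φ : ℂ) * (angleSpeed 0 φ : ℂ) := by
        have := congrArg (fun F : HalfTurn => F φ) h1
        simpa [f, speed] using this
      -- The squares agree, so only the sign is open. The negative root is excluded because Q stays
      -- within 1/2 of P₀, while P₀ ≥ 1/2 and the speed is positive.
      have e2 : (Q k φ - (angleSpeed k φ : ℂ)) * (Q k φ + (angleSpeed k φ : ℂ)) = 0 := by
        have a1 := angleSpeed_sq h3 (φ : ℝ)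
        have a2 := angleSpeed_sq (k := 0) (by norm_num) (φ : ℝ)
        have a3 : angleSpeed k φ ^ 2 = k + angleSpeed 0 φ ^ 2 := by rw [a1, a2]; ring
        have a4 : (angleSpeed k φ : ℂ) ^ 2 = k + (angleSpeed 0 φ : ℂ) ^ 2 := by exact_mod_cast a3
        linear_combination e1 - a4
      rcases mul_eq_zero.1 e2 with h | h
      · exact sub_eq_zero.1 h
      · exfalso
        have b1 : ‖(Q k - speed 0) φ‖ < 1 / 2 := lt_of_le_of_lt ((Q k - speed 0).norm_coe_le_norm φ) h2
        have b2 : (Q k - speed 0) φ = -((angleSpeed k φ + angleSpeed 0 φ : ℝ) : ℂ) := by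
          have : (Q k - speed 0) φ = Q k φ - (angleSpeed 0 φ : ℂ) := rfl
          rw [this]
          push_cast
          linear_combination h
        have b3 := angleSpeed_pos h3 (φ : ℝ)
        have b4 : (1 / 2 : ℝ) ≤ angleSpeed 0 φ := by
          refine Real.le_sqrt_of_sq_le ?_
          nlinarith [sq_nonneg (Real.cos φ)]
        rw [b2, norm_neg, Complex.norm_real, Real.norm_of_nonneg (by linarith)] at b1
        linarith
    have hmul : Q k * Ring.inverse (Q k) = 1 := by
      refine Ring.mul_inverse_cancel _ ?_
      rw [ContinuousMap.isUnit_iff_forall_ne_zero]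
      intro ψ
      rw [hval]
      exact Complex.ofReal_ne_zero.2 (angleSpeed_pos h3 _).ne'
    have e := congrArg (fun F : HalfTurn => F ⟨φ, hφ⟩) hmul
    rw [ext_of_mem _ hφ]
    have e' : (angleSpeed k φ : ℂ) * Ring.inverse (Q k) ⟨φ, hφ⟩ = 1 := by
      rw [← hval ⟨φ, hφ⟩]; exact e
    rw [Complex.ofReal_inv]
    exact eq_inv_of_mul_eq_one_right e'

end HalfTurn

/-! ### Explicit Hill solutions at η = 0 and the virial identity. -/

section ExplicitSolutions

variable {k : ℝ}

lemma hasDerivAt_sin_mul_angleSpeed (hk : -(1 / 2) < k) (φ : ℝ) :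
    HasDerivAt (fun φ => Real.sin φ * angleSpeed k φ)
      ((angleSpeed k φ)⁻¹ * (Real.cos φ * (k + Real.cos φ ^ 2))) φ := by
  refine ((Real.hasDerivAt_sin φ).mul (hasDerivAt_angleSpeed hk φ)).congr_deriv ?_
  have hP := (angleSpeed_pos hk φ).ne'
  have h2 := angleSpeed_sq hk φ
  have h3 := Real.sin_sq_add_cos_sq φ
  field_simp
  rw [h2]
  linear_combination (-Real.cos φ) * h3

/-- Up to sign this is the velocity u' of the orbit u = cos φ, which solves the linearized equation
by time translation invariance. -/
lemma hillSolution_sine (hk : -(1 / 2) < k) (D : Set ℝ) : HillSolution k 0 D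
    (fun φ => ((Real.sin φ * angleSpeed k φ : ℝ) : ℂ))
    (fun φ => ((Real.cos φ * (k + Real.cos φ ^ 2) : ℝ) : ℂ)) := by
  refine ⟨fun φ _ => ?_, fun φ _ => ?_⟩
  · refine ((hasDerivAt_sin_mul_angleSpeed hk φ).ofReal_comp.hasDerivWithinAt).congr_deriv ?_
    push_cast; ring
  · have h : HasDerivAt (fun φ => Real.cos φ * (k + Real.cos φ ^ 2))
        (-(k + 3 * Real.cos φ ^ 2) * (angleSpeed k φ)⁻¹ * (Real.sin φ * angleSpeed k φ)) φ := by
      refine ((Real.hasDerivAt_cos φ).mul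
        (((Real.hasDerivAt_cos φ).pow 2).const_add k)).congr_deriv ?_
      have hP := (angleSpeed_pos hk φ).ne'
      simp only [Pi.pow_apply]
      field_simp
      norm_num
      ring
    refine (h.ofReal_comp.hasDerivWithinAt).congr_deriv ?_
    push_cast; ring

lemma hasDerivAt_angleTime (hk : -(1 / 2) < k) (φ : ℝ) :
    HasDerivAt (fun φ => ∫ ψ in (0 : ℝ)..φ, (angleSpeed k ψ)⁻¹) (angleSpeed k φ)⁻¹ φ :=
  (continuous_inv_angleSpeed hk).integral_hasStrictDerivAt 0 φ |>.hasDerivAt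

/-- For k = 0 the family λ u(λt) consists of solutions of u'' + u³ = 0; its derivative at λ = 1 is u
+ t u', written here in the angle. -/
lemma hillSolution_cosine (D : Set ℝ) : HillSolution 0 0 D
    (fun φ => ((Real.cos φ - (∫ ψ in (0 : ℝ)..φ, (angleSpeed 0 ψ)⁻¹) *
      (Real.sin φ * angleSpeed 0 φ) : ℝ) : ℂ))
    (fun φ => ((-2 * (Real.sin φ * angleSpeed 0 φ) - (∫ ψ in (0 : ℝ)..φ, (angleSpeed 0 ψ)⁻¹) *
      Real.cos φ ^ 3 : ℝ) : ℂ)) := by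
  have hk : (-(1 / 2) : ℝ) < 0 := by norm_num
  refine ⟨fun φ _ => ?_, fun φ _ => ?_⟩
  · have h := (Real.hasDerivAt_cos φ).sub
      ((hasDerivAt_angleTime hk φ).mul (hasDerivAt_sin_mul_angleSpeed hk φ))
    refine (h.ofReal_comp.hasDerivWithinAt).congr_deriv ?_
    rw [← Complex.ofReal_mul]
    congr 1
    have hP := (angleSpeed_pos hk φ).ne'
    field_simp
    ring
  · have h := ((hasDerivAt_sin_mul_angleSpeed hk φ).const_mul (-2)).sub
      ((hasDerivAt_angleTime hk φ).mul ((Real.hasDerivAt_cos φ).pow 3))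
    refine (h.ofReal_comp.hasDerivWithinAt).congr_deriv ?_
    have e : ∀ x y z : ℝ, -(((0 : ℝ) : ℂ) + 0 + 3 * (x : ℂ) ^ 2) * (y : ℂ) * (z : ℂ) =
      ((-(3 * x ^ 2) * y * z : ℝ) : ℂ) := by intros; push_cast; ring
    rw [e]
    congr 1
    have hP := (angleSpeed_pos hk φ).ne'
    simp only [Pi.pow_apply]
    field_simp
    norm_num
    ring

/-- The mean kinetic energy of the orbit of `u'' + u³ = 0` through `u = 1`, `u' = 0`. -/
lemma integral_sin_sq_mul_angleSpeed :
    3 * ∫ φ in (0 : ℝ)..Real.pi, Real.sin φ ^ 2 * angleSpeed 0 φ =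
      ∫ φ in (0 : ℝ)..Real.pi, (angleSpeed 0 φ)⁻¹ := by
  have hk : (-(1 / 2) : ℝ) < 0 := by norm_num
  have hc := continuous_inv_angleSpeed hk
  have hc' := continuous_angleSpeed 0
  -- The function is -u u'. By energy conservation its time derivative u⁴ - u'² equals 1 - 3u'², and
  -- it vanishes at both ends.
  have h : ∀ φ ∈ uIcc 0 Real.pi, HasDerivAt (fun φ => Real.cos φ * (Real.sin φ * angleSpeed 0 φ))
      ((angleSpeed 0 φ)⁻¹ - 3 * (Real.sin φ ^ 2 * angleSpeed 0 φ)) φ := by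
    intro φ _
    refine ((Real.hasDerivAt_cos φ).mul (hasDerivAt_sin_mul_angleSpeed hk φ)).congr_deriv ?_
    have hP := (angleSpeed_pos hk φ).ne'
    have h2 := angleSpeed_sq hk φ
    have h3 := Real.sin_sq φ
    field_simp
    rw [h2, h3]
    ring
  have e := intervalIntegral.integral_eq_sub_of_hasDerivAt h
    (Continuous.intervalIntegrable (by fun_prop) _ _)
  rw [intervalIntegral.integral_sub (hc.intervalIntegrable _ _)
    (Continuous.intervalIntegrable (by fun_prop) _ _), intervalIntegral.integral_const_mul] at e
  simp at e
  linarith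

end ExplicitSolutions

/-! ### The trace of the half-period monodromy as an analytic function. -/

/-- The half period of `u'' + k u + u³ = 0`, `u(0) = 1`, `u'(0) = 0`. -/
noncomputable def halfPeriod (k : ℝ) : ℝ := ∫ φ in (0 : ℝ)..Real.pi, (angleSpeed k φ)⁻¹

lemma halfPeriod_pos {k : ℝ} (hk : -(1 / 2) < k) : 0 < halfPeriod k :=
  intervalIntegral.intervalIntegral_pos_of_pos
    ((continuous_inv_angleSpeed hk).intervalIntegrable _ _)
    (fun φ => inv_pos.2 (angleSpeed_pos hk φ)) Real.pi_pos

namespace HalfTurn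

/-- The coefficient of the Hill system for complex parameters, given the inverse angle speed. -/
noncomputable def hillCoeff (g : ℂ → HalfTurn) (z : ℂ × ℂ) : HalfTurn :=
  -(z.1 • 1 + z.2 • 1 + (3 : ℂ) • (cosine * cosine)) * g z.1

/-- The solution of the Hill system with initial data `e`. -/
noncomputable def hillSolve (g : ℂ → HalfTurn) (e z : ℂ × ℂ) : HalfTurn × HalfTurn :=
  solve e (g z.1) (hillCoeff g z)

/-- Evaluation at `π`. -/
noncomputable def evalPi : HalfTurn →L[ℂ] ℂ := ContinuousMap.evalCLM ℂ
    (⟨Real.pi, right_mem_Icc.2 Real.pi_pos.le⟩ : Icc (0 : ℝ) Real.pi)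

lemma evalPi_apply (f : HalfTurn) : evalPi f = f.ext Real.pi :=
  (f.ext_of_mem (right_mem_Icc.2 Real.pi_pos.le)).symm

/-- The product integral `∫ g w₁ w₂`, with `w₁` a solution for `η = 0`. -/
noncomputable def hillPairing (g : ℂ → HalfTurn) (e e' z : ℂ × ℂ) : ℂ :=
  integral (g z.1 * ((hillSolve g e (z.1, 0)).1 * (hillSolve g e' z).1))

/-- The difference quotient in `η` of the negative trace of the monodromy. -/
noncomputable def discriminantQuotient (g : ℂ → HalfTurn) (z : ℂ × ℂ) : ℂ :=
  hillPairing g (0, 1) (1, 0) z - hillPairing g (1, 0) (0, 1) z -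
    evalPi (hillSolve g (1, 0) (z.1, 0)).2 * hillPairing g (0, 1) (0, 1) z

variable {g : ℂ → HalfTurn}

lemma contDiffAt_hillSolve (hg : ContDiffAt ℂ ω g 0) (e : ℂ × ℂ) :
    ContDiffAt ℂ ω (hillSolve g e) (0, 0) := by
  have hgz : ContDiffAt ℂ ω (fun z : ℂ × ℂ => g z.1) (0, 0) :=
    ContDiffAt.comp (0, 0) (g := g) (f := Prod.fst) hg contDiffAt_fst
  have h1 : ContDiffAt ℂ ω (fun z : ℂ × ℂ => z.1 • (1 : HalfTurn)) (0, 0) := by fun_prop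
  have h2 : ContDiffAt ℂ ω (fun z : ℂ × ℂ => z.2 • (1 : HalfTurn)) (0, 0) := by fun_prop
  have h3 : ContDiffAt ℂ ω (fun z : ℂ × ℂ =>
      -(z.1 • (1 : HalfTurn) + z.2 • 1 + (3 : ℂ) • (cosine * cosine))) (0, 0) :=
    ((h1.add h2).add contDiffAt_const).neg
  have hK : ContDiffAt ℂ ω (hillCoeff g) (0, 0) := h3.mul hgz
  have h5 : ContDiffAt ℂ ω (fun z => (g z.1, hillCoeff g z)) ((0, 0) : ℂ × ℂ) := hgz.prodMk hK
  have h4 : ContDiffAt ℂ ω (fun z : HalfTurn × HalfTurn => solve e z.1 z.2)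
      ((fun z => (g z.1, hillCoeff g z)) ((0, 0) : ℂ × ℂ)) := contDiffAt_solve e _
  exact ContDiffAt.comp (f := fun z => (g z.1, hillCoeff g z)) ((0, 0) : ℂ × ℂ) h4 h5

lemma contDiffAt_hillSolve_zero (hg : ContDiffAt ℂ ω g 0) (e : ℂ × ℂ) :
    ContDiffAt ℂ ω (fun z : ℂ × ℂ => hillSolve g e (z.1, 0)) (0, 0) :=
  ContDiffAt.comp (0, 0) (g := hillSolve g e) (f := fun z : ℂ × ℂ => (z.1, (0 : ℂ)))
    (contDiffAt_hillSolve hg e) (contDiffAt_fst.prodMk contDiffAt_const)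

lemma contDiffAt_hillPairing (hg : ContDiffAt ℂ ω g 0) (e e' : ℂ × ℂ) :
    ContDiffAt ℂ ω (hillPairing g e e') (0, 0) := by
  have hgz : ContDiffAt ℂ ω (fun z : ℂ × ℂ => g z.1) (0, 0) :=
    ContDiffAt.comp (0, 0) (g := g) (f := Prod.fst) hg contDiffAt_fst
  have h := hgz.mul ((contDiffAt_hillSolve_zero hg e).fst.mul (contDiffAt_hillSolve hg e').fst)
  exact integral.contDiff.contDiffAt.comp _ h

lemma contDiffAt_evalPi (hg : ContDiffAt ℂ ω g 0) (e : ℂ × ℂ) :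
    ContDiffAt ℂ ω (fun z : ℂ × ℂ => evalPi (hillSolve g e (z.1, 0)).2) (0, 0) :=
  evalPi.contDiff.contDiffAt.comp _ (contDiffAt_hillSolve_zero hg e).snd

lemma contDiffAt_discriminantQuotient (hg : ContDiffAt ℂ ω g 0) :
    ContDiffAt ℂ ω (discriminantQuotient g) (0, 0) :=
  ((contDiffAt_hillPairing hg _ _).sub (contDiffAt_hillPairing hg _ _)).sub
    ((contDiffAt_evalPi hg _).mul (contDiffAt_hillPairing hg _ _))

variable {k : ℝ} (hk : ∀ φ ∈ Icc 0 Real.pi, (g k).ext φ = (((angleSpeed k φ)⁻¹ : ℝ) : ℂ))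
  (hk1 : -(1 / 2) < k)

lemma hillSolve_fst_zero (g : ℂ → HalfTurn) (e z : ℂ × ℂ) : (hillSolve g e z).1.ext 0 = e.1 :=
  (solve_ext_zero _ _ _).1

lemma hillSolve_snd_zero (g : ℂ → HalfTurn) (e z : ℂ × ℂ) : (hillSolve g e z).2.ext 0 = e.2 :=
  (solve_ext_zero _ _ _).2

include hk in
lemma hillSolution_hillSolve (η : ℂ) (e : ℂ × ℂ) : HillSolution k η (Icc 0 Real.pi)
    (hillSolve g e (k, η)).1.ext (hillSolve g e (k, η)).2.ext := by
  refine ⟨fun φ hφ => ?_, fun φ hφ => ?_⟩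
  · rw [← hk φ hφ]
    exact hasDerivWithinAt_solve_fst e _ _ hφ
  · refine (hasDerivWithinAt_solve_snd e _ _ hφ).congr_deriv ?_
    have hc : cosine.ext φ = (Real.cos φ : ℂ) := by
      rw [ext_of_mem _ hφ]; rfl
    have hK : (hillCoeff g (k, η)).ext φ =
        -(k + η + 3 * (Real.cos φ : ℂ) ^ 2) * ((angleSpeed k φ)⁻¹ : ℝ) := by
      simp only [hillCoeff, ext_mul, ext_neg, ext_add, ext_smul, ext_one, hk φ hφ, hc]
      ring
    rw [hK, hillSolve]

include hk in
lemma integral_mul_of_inv_speed (u v : HalfTurn) : integral (g k * (u * v)) =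
    ∫ φ in (0 : ℝ)..Real.pi, ((angleSpeed k φ)⁻¹ : ℝ) * (u.ext φ * v.ext φ) := by
  rw [integral_apply]
  refine intervalIntegral.integral_congr fun φ hφ => ?_
  rw [uIcc_of_le Real.pi_pos.le] at hφ
  simp only [ext_mul, hk φ hφ]

include hk in
lemma integral_inv_speed : integral (g k) = halfPeriod k := by
  rw [integral_apply, halfPeriod, ← intervalIntegral.integral_ofReal]
  refine intervalIntegral.integral_congr fun φ hφ => ?_
  rw [uIcc_of_le Real.pi_pos.le] at hφ
  exact hk φ hφ

include hk hk1 in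
lemma hillSolve_sine {φ : ℝ} (hφ : φ ∈ Icc 0 Real.pi) :
    (hillSolve g (0, 1) (k, 0)).1.ext φ = (1 + k : ℂ)⁻¹ * ((Real.sin φ * angleSpeed k φ : ℝ) : ℂ) ∧
    (hillSolve g (0, 1) (k, 0)).2.ext φ =
      (1 + k : ℂ)⁻¹ * ((Real.cos φ * (k + Real.cos φ ^ 2) : ℝ) : ℂ) := by
  have hne : (1 + k : ℂ) ≠ 0 := by
    have : (1 + k : ℝ) ≠ 0 := by linarith
    exact_mod_cast this
  refine (hillSolution_hillSolve hk 0 (0, 1)).eq_of_initial hk1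
    ((hillSolution_sine hk1 _).const_mul (1 + k : ℂ)⁻¹) ?_ ?_ φ hφ
  · rw [hillSolve_fst_zero]; simp
  · rw [hillSolve_snd_zero]
    simp only [Real.cos_zero]
    push_cast
    field_simp
    ring

lemma hillSolve_cosine_pi
    (hk : ∀ φ ∈ Icc 0 Real.pi, (g (0 : ℝ)).ext φ = (((angleSpeed 0 φ)⁻¹ : ℝ) : ℂ)) :
    (hillSolve g (1, 0) ((0 : ℝ), 0)).2.ext Real.pi = halfPeriod 0 := by
  have h := ((hillSolution_hillSolve hk 0 (1, 0)).eq_of_initial (by norm_num)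
    (hillSolution_cosine _) ?_ ?_ Real.pi (right_mem_Icc.2 Real.pi_pos.le)).2
  · rw [h]
    simp [halfPeriod]
    ring
  · rw [hillSolve_fst_zero]; simp
  · rw [hillSolve_snd_zero]; simp

include hk hk1 in
-- Green's identity between solutions for η and for 0 expresses every change of the monodromy as η
-- times an integral, so division by η needs no limit. At η = 0 the velocity solution s has end
-- values (0, -1), and the Wronskian then forces c(π) = -1.
lemma trace_monodromy (η : ℂ) :
    -((hillSolve g (1, 0) (k, η)).1.ext Real.pi + (hillSolve g (0, 1) (k, η)).2.ext Real.pi) =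
      2 + η * discriminantQuotient g (k, η) := by
  have hpi := hillSolve_sine hk hk1 (right_mem_Icc.2 Real.pi_pos.le)
  have hne1 : (1 + k : ℂ) ≠ 0 := by
    have : (1 + k : ℝ) ≠ 0 := by linarith
    exact_mod_cast this
  have s0 : (hillSolve g (0, 1) (k, 0)).1.ext Real.pi = 0 := by rw [hpi.1]; simp
  have s0' : (hillSolve g (0, 1) (k, 0)).2.ext Real.pi = -1 := by
    rw [hpi.2, Real.cos_pi]
    push_cast
    field_simp
    ring
  have w0 := (hillSolution_hillSolve hk 0 (1, 0)).wronskian hk1 (hillSolution_hillSolve hk 0 (0, 1))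
  have w1 := (hillSolution_hillSolve hk 0 (0, 1)).wronskian hk1 (hillSolution_hillSolve hk η (1, 0))
  have w2 := (hillSolution_hillSolve hk 0 (1, 0)).wronskian hk1 (hillSolution_hillSolve hk η (0, 1))
  have w3 := (hillSolution_hillSolve hk 0 (0, 1)).wronskian hk1 (hillSolution_hillSolve hk η (0, 1))
  rw [← integral_mul_of_inv_speed hk] at w1 w2 w3
  simp only [hillSolve_fst_zero, hillSolve_snd_zero, s0, s0'] at w0 w1 w2 w3
  simp only [discriminantQuotient, hillPairing, evalPi_apply]
  have c0 : (hillSolve g (1, 0) (k, 0)).1.ext Real.pi = -1 := by linear_combination -w0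
  rw [c0] at w2
  linear_combination (-1 : ℂ) * w1 + w2 + (hillSolve g (1, 0) (k, 0)).2.ext Real.pi * w3

/-- At η = 0 the two mixed pairings cancel. What remains is -c'(π) ∫ s²/P, where c'(π) = q by the
scaling solution and the integral is q/3 by the virial identity. -/
lemma discriminantQuotient_zero
    (hk : ∀ φ ∈ Icc 0 Real.pi, (g (0 : ℝ)).ext φ = (((angleSpeed 0 φ)⁻¹ : ℝ) : ℂ)) :
    discriminantQuotient g ((0 : ℝ), 0) = -(halfPeriod 0 : ℂ) ^ 2 / 3 := by
  have e2 : hillPairing g (0, 1) (0, 1) ((0 : ℝ), 0) =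
      ((∫ φ in (0 : ℝ)..Real.pi, Real.sin φ ^ 2 * angleSpeed 0 φ : ℝ) : ℂ) := by
    rw [hillPairing, integral_mul_of_inv_speed hk, ← intervalIntegral.integral_ofReal]
    refine intervalIntegral.integral_congr fun φ hφ => ?_
    rw [uIcc_of_le Real.pi_pos.le] at hφ
    have hs := (hillSolve_sine hk (by norm_num) hφ).1
    have hP : (angleSpeed 0 φ : ℂ) ≠ 0 :=
      Complex.ofReal_ne_zero.2 (angleSpeed_pos (by norm_num) φ).ne'
    simp only [hs]
    push_cast
    field_simp
    ring
  have e1 : hillPairing g (0, 1) (1, 0) ((0 : ℝ), 0) = hillPairing g (1, 0) (0, 1) ((0 : ℝ), 0) := by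
    rw [hillPairing, hillPairing, mul_comm (hillSolve g (0, 1) _).1]
  have e3 := integral_sin_sq_mul_angleSpeed
  have e4 : (3 : ℂ) * ((∫ φ in (0 : ℝ)..Real.pi, Real.sin φ ^ 2 * angleSpeed 0 φ : ℝ) : ℂ) =
    (halfPeriod 0 : ℂ) := by exact_mod_cast e3
  rw [discriminantQuotient, e1, e2, evalPi_apply, hillSolve_cosine_pi hk]
  linear_combination (-(halfPeriod 0 : ℂ) / 3) * e4

end HalfTurn

/-- The half-period monodromy of the Hill system depends analytically on the parameters near `0`.
The negative of its trace is `2 + η G(k, η)`. -/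
theorem exists_analytic_discriminant : ∃ (q : ℂ → ℂ) (G : ℂ × ℂ → ℂ),
    ContDiffAt ℂ ω q 0 ∧ ContDiffAt ℂ ω G (0, 0) ∧ q 0 ≠ 0 ∧ G (0, 0) = -(q 0) ^ 2 / 3 ∧
    ∀ᶠ k : ℝ in 𝓝 0, q k = halfPeriod k ∧ ∀ η : ℂ, ∃ c c' s s' : ℝ → ℂ,
      HillSolution k η (Icc 0 Real.pi) c c' ∧ HillSolution k η (Icc 0 Real.pi) s s' ∧
      c 0 = 1 ∧ c' 0 = 0 ∧ s 0 = 0 ∧ s' 0 = 1 ∧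
      -(c Real.pi + s' Real.pi) = 2 + η * G (k, η) ∧ (η = 0 → c' Real.pi ≠ 0) := by
  obtain ⟨g, hg, hgk⟩ := HalfTurn.exists_analytic_inv_speed
  have hk0 := hgk.self_of_nhds
  have hq0 : HalfTurn.integral (g 0) = halfPeriod 0 := by
    have := HalfTurn.integral_inv_speed hk0
    simpa only [Complex.ofReal_zero] using this
  have hq0ne : (halfPeriod 0 : ℂ) ≠ 0 :=
    Complex.ofReal_ne_zero.2 (halfPeriod_pos (by norm_num)).ne'
  refine ⟨fun k => HalfTurn.integral (g k), HalfTurn.discriminantQuotient g,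
    HalfTurn.integral.contDiff.contDiffAt.comp _ hg, HalfTurn.contDiffAt_discriminantQuotient hg,
    by simpa only [hq0] using hq0ne, ?_, ?_⟩
  · have := HalfTurn.discriminantQuotient_zero hk0
    simpa only [Complex.ofReal_zero, hq0] using this
  · have hcont : ContinuousAt
        (fun k : ℝ => HalfTurn.evalPi (HalfTurn.hillSolve g (1, 0) ((k : ℂ), 0)).2) 0 := by
      have h2 : ContinuousAt (fun k : ℝ => ((k : ℂ), (0 : ℂ))) 0 := by fun_prop
      have h1 := (HalfTurn.contDiffAt_evalPi hg (1, 0)).continuousAt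
      exact ContinuousAt.comp (f := fun k : ℝ => ((k : ℂ), (0 : ℂ)))
        (g := fun z : ℂ × ℂ => HalfTurn.evalPi (HalfTurn.hillSolve g (1, 0) (z.1, 0)).2)
        (by simpa only [Complex.ofReal_zero] using h1) h2
    -- At k = 0 this entry equals the half period, so by continuity the monodromy differs from the
    -- negative of the identity for all small k.
    have hne : ∀ᶠ k : ℝ in 𝓝 0,
        HalfTurn.evalPi (HalfTurn.hillSolve g (1, 0) ((k : ℂ), 0)).2 ≠ 0 := by
      refine hcont.eventually_ne ?_
      rw [HalfTurn.evalPi_apply, HalfTurn.hillSolve_cosine_pi hk0]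
      exact hq0ne
    filter_upwards [hgk, Ioi_mem_nhds (show (-(1 / 2) : ℝ) < 0 by norm_num), hne] with k hk hk1 hk2
    refine ⟨HalfTurn.integral_inv_speed hk, fun η => ⟨_, _, _, _,
      HalfTurn.hillSolution_hillSolve hk η (1, 0), HalfTurn.hillSolution_hillSolve hk η (0, 1),
      HalfTurn.hillSolve_fst_zero _ _ _, HalfTurn.hillSolve_snd_zero _ _ _,
      HalfTurn.hillSolve_fst_zero _ _ _, HalfTurn.hillSolve_snd_zero _ _ _,
      HalfTurn.trace_monodromy hk hk1 η, ?_⟩⟩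
    rintro rfl
    rw [← HalfTurn.evalPi_apply]
    exact hk2

/-! ### The characteristic equation and the exponent of the nontrivial multiplier. -/

/-- The entire function `sinh z / z`. -/
noncomputable def sinhc : ℂ → ℂ := dslope Complex.sinh 0

lemma mul_sinhc (z : ℂ) : z * sinhc z = Complex.sinh z := by
  simpa [sinhc] using sub_smul_dslope Complex.sinh 0 z

lemma sinhc_zero : sinhc 0 = 1 := by
  simp [sinhc, dslope_same, Complex.deriv_sinh]

lemma contDiff_sinhc : ContDiff ℂ ω sinhc := by
  have h : Differentiable ℂ sinhc := by
    rw [← differentiableOn_univ]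
    exact (Complex.differentiableOn_dslope univ_mem).2 Complex.differentiable_sinh.differentiableOn
  exact h.contDiff

/-- The left side is 4 sinh²(θ/2). Splitting off the double zero leaves a factor that is 1 at θ = 0.
-/
lemma exp_add_exp_neg_sub_two (θ : ℂ) :
    Complex.exp θ + Complex.exp (-θ) - 2 = θ ^ 2 * sinhc (θ / 2) ^ 2 := by
  have h := mul_sinhc (θ / 2)
  have h1 : θ ^ 2 * sinhc (θ / 2) ^ 2 = 4 * (θ / 2 * sinhc (θ / 2)) ^ 2 := by ring
  have h2 : Complex.exp (θ / 2) * Complex.exp (-(θ / 2)) = 1 := by rw [← Complex.exp_add]; simp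
  have h3 : Complex.exp θ = Complex.exp (θ / 2) ^ 2 := by rw [← Complex.exp_nat_mul]; ring_nf
  have h4 : Complex.exp (-θ) = Complex.exp (-(θ / 2)) ^ 2 := by
    rw [← Complex.exp_nat_mul]; push_cast; ring_nf
  rw [h1, h, Complex.sinh, h3, h4]
  linear_combination (2 : ℂ) * h2

lemma exp_sub_one_eq_sinhc (z : ℂ) :
    Complex.exp z - 1 = z * (Complex.exp (z / 2) * sinhc (z / 2)) := by
  have h := mul_sinhc (z / 2)
  have h2 : Complex.exp (z / 2) * Complex.exp (-(z / 2)) = 1 := by rw [← Complex.exp_add]; simp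
  have h3 : Complex.exp z = Complex.exp (z / 2) ^ 2 := by rw [← Complex.exp_nat_mul]; ring_nf
  rw [show z * (Complex.exp (z / 2) * sinhc (z / 2)) =
    2 * Complex.exp (z / 2) * (z / 2 * sinhc (z / 2)) by ring, h, Complex.sinh, h3]
  linear_combination h2

/-- The scalar function of `((k, θ), (ℓ, η))` whose fixed point equation determines the exponent of
the nontrivial multiplier. -/
noncomputable def exponentMap (β : ℝ) (q : ℂ → ℂ) (G : ℂ × ℂ → ℂ) (z : (ℂ × ℂ) × (ℂ × ℂ)) : ℂ :=
  β * (Complex.exp (z.2.1 / 2) * sinhc (z.2.1 / 2)) * G (z.1.1, z.2.2) /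
    (q z.1.1 * sinhc (z.1.2 / 2)) ^ 2

/-- The arguments of `exponentMap` in terms of `((r, T), m)`. -/
noncomputable def exponentArgs (α β : ℝ) (q : ℂ → ℂ) (v : (ℂ × ℂ) × ℂ) : (ℂ × ℂ) × (ℂ × ℂ) :=
  ((v.1.1 ^ 2 * α, v.1.2 * v.2 * v.1.1 * q (v.1.1 ^ 2 * α)),
    (v.1.2 ^ 2 * v.2, v.1.1 ^ 2 * β * (Complex.exp (v.1.2 ^ 2 * v.2) - 1)))

section Exponent

variable {α β : ℝ} {q : ℂ → ℂ} {G : ℂ × ℂ → ℂ}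

/-- The square of the half period cancels against G(0, 0); this is the origin of the coefficient 1/3
in the expansion of σ. -/
lemma exponentMap_zero (hq0 : q 0 ≠ 0) (hG0 : G (0, 0) = -(q 0) ^ 2 / 3) :
    exponentMap β q G ((0, 0), (0, 0)) = -β / 3 := by
  simp only [exponentMap, zero_div, Complex.exp_zero, sinhc_zero, hG0]
  field_simp

lemma contDiffAt_exponentMap (hq : ContDiffAt ℂ ω q 0) (hG : ContDiffAt ℂ ω G (0, 0))
    (hq0 : q 0 ≠ 0) : ContDiffAt ℂ ω (exponentMap β q G) ((0, 0), (0, 0)) := by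
  have h1 : ContDiffAt ℂ ω (fun z : (ℂ × ℂ) × (ℂ × ℂ) => q z.1.1) ((0, 0), (0, 0)) :=
    ContDiffAt.comp (f := fun z : (ℂ × ℂ) × (ℂ × ℂ) => z.1.1) (g := q) ((0, 0), (0, 0)) hq
      (by fun_prop)
  have h2 : ContDiffAt ℂ ω (fun z : (ℂ × ℂ) × (ℂ × ℂ) => G (z.1.1, z.2.2)) ((0, 0), (0, 0)) :=
    ContDiffAt.comp (f := fun z : (ℂ × ℂ) × (ℂ × ℂ) => (z.1.1, z.2.2)) (g := G)
      ((0, 0), (0, 0)) hG (by fun_prop)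
  have h3 : ContDiffAt ℂ ω (fun z : (ℂ × ℂ) × (ℂ × ℂ) => sinhc (z.2.1 / 2)) ((0, 0), (0, 0)) :=
    contDiff_sinhc.contDiffAt.comp _ (by fun_prop)
  have h4 : ContDiffAt ℂ ω (fun z : (ℂ × ℂ) × (ℂ × ℂ) => sinhc (z.1.2 / 2)) ((0, 0), (0, 0)) :=
    contDiff_sinhc.contDiffAt.comp _ (by fun_prop)
  have h5 : ContDiffAt ℂ ω (fun z : (ℂ × ℂ) × (ℂ × ℂ) => Complex.exp (z.2.1 / 2))
      ((0, 0), (0, 0)) := by fun_prop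
  unfold exponentMap
  refine ((contDiffAt_const.mul (h5.mul h3)).mul h2).div ((h1.mul h4).pow 2) ?_
  simpa [sinhc_zero] using hq0

lemma exponentArgs_zero (m : ℂ) : exponentArgs α β q ((0, 0), m) = ((0, 0), (0, 0)) := by
  simp [exponentArgs]

lemma contDiffAt_exponentArgs (hq : ContDiffAt ℂ ω q 0) (m : ℂ) :
    ContDiffAt ℂ ω (exponentArgs α β q) ((0, 0), m) := by
  have h0 : ContDiffAt ℂ ω (fun v : (ℂ × ℂ) × ℂ => v.1.1 ^ 2 * (α : ℂ)) ((0, 0), m) := by fun_prop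
  have h1 : ContDiffAt ℂ ω (fun v : (ℂ × ℂ) × ℂ => q (v.1.1 ^ 2 * α)) ((0, 0), m) :=
    ContDiffAt.comp (f := fun v : (ℂ × ℂ) × ℂ => v.1.1 ^ 2 * (α : ℂ)) (g := q) ((0, 0), m)
      (by simpa using hq) h0
  exact (h0.prodMk (ContDiffAt.mul (by fun_prop) h1)).prodMk (by fun_prop)

/-- The implicit function theorem for the exponent `m` of the nontrivial multiplier. -/
lemma exists_exponent (hq : ContDiffAt ℂ ω q 0) (hG : ContDiffAt ℂ ω G (0, 0))
    (hq0 : q 0 ≠ 0) (hG0 : G (0, 0) = -(q 0) ^ 2 / 3) :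
    ∃ M : ℂ × ℂ → ℂ, ContDiffAt ℂ ω M (0, 0) ∧ M (0, 0) = -β / 3 ∧
      ∀ᶠ v in 𝓝 (((0, 0), -β / 3) : (ℂ × ℂ) × ℂ),
        v.2 = exponentMap β q G (exponentArgs α β q v) ↔ M v.1 = v.2 := by
  set m₀ : ℂ := -β / 3
  let Q : (ℂ × ℂ) × ℂ → ℂ := fun v => exponentMap β q G (exponentArgs α β q v)
  -- At r = T = 0 all arguments collapse to zero whatever m is. Hence m ↦ m - Q has derivative 1
  -- there, and the implicit function theorem applies at once.
  have hQ0 : ∀ m, Q ((0, 0), m) = m₀ := fun m => by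
    simp only [Q, exponentArgs_zero]; exact exponentMap_zero hq0 hG0
  have hQ : ContDiffAt ℂ ω Q ((0, 0), m₀) :=
    ContDiffAt.comp (f := exponentArgs α β q) (g := exponentMap β q G) ((0, 0), m₀)
      (by rw [exponentArgs_zero]; exact contDiffAt_exponentMap hq hG hq0)
      (contDiffAt_exponentArgs hq m₀)
  let f : (ℂ × ℂ) × ℂ → ℂ := fun v => v.2 - Q v
  have hf : ContDiffAt ℂ ω f ((0, 0), m₀) := contDiffAt_snd.sub hQ
  have hinv : (fderiv ℂ f ((0, 0), m₀) ∘L .inr ℂ (ℂ × ℂ) ℂ).IsInvertible := by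
    have h2 : HasFDerivAt (fun x : ℂ => ((0, 0), x)) (.inr ℂ (ℂ × ℂ) ℂ) m₀ :=
      hasFDerivAt_prodMk_right (0 : ℂ × ℂ) m₀
    have h3 := (HasFDerivAt.comp m₀ (g := f) (hf.differentiableAt (by simp)).hasFDerivAt h2)
    have h4 : f ∘ (fun x : ℂ => (((0, 0), x) : (ℂ × ℂ) × ℂ)) = fun x => x - m₀ := by
      funext x
      simp [f, hQ0]
    rw [h4] at h3
    have h5 : HasFDerivAt (fun x : ℂ => x - m₀) (ContinuousLinearMap.id ℂ ℂ) m₀ :=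
      (hasFDerivAt_id m₀).sub_const m₀
    rw [h3.unique h5]
    exact ⟨ContinuousLinearEquiv.refl ℂ ℂ, rfl⟩
  refine ⟨hf.implicitFunction (by simp) hinv, hf.contDiffAt_implicitFunction (by simp) hinv,
    hf.implicitFunction_apply_self (by simp) hinv, ?_⟩
  filter_upwards [hf.eventually_apply_eq_iff_implicitFunction (by simp) hinv] with v hv
  rw [← hv]
  simp only [f, hQ0, sub_self, sub_eq_zero]
  rfl

/-- The characteristic equation is equivalent to the fixed point equation for the exponent. -/
lemma characteristic_iff {r T k θ l η : ℂ} (n : ℕ) (hr : r ≠ 0) (hT : T ≠ 0) (hl : l ≠ 0)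
    (hTn : T = n * r * q k) (hln : l = n * θ) (hs : sinhc (θ / 2) ≠ 0)
    (hη : η = r ^ 2 * β * (Complex.exp l - 1)) :
    Complex.exp θ + Complex.exp (-θ) = 2 + η * G (k, η) ↔
      l / T ^ 2 = exponentMap β q G ((k, θ), (l, η)) := by
  have hq0 : q k ≠ 0 := by rintro h; exact hT (by rw [hTn, h, mul_zero])
  have hn : (n : ℂ) ≠ 0 := by rintro h; exact hT (by rw [hTn, h]; ring)
  have hθ : θ ≠ 0 := by rintro rfl; exact hl (by rw [hln, mul_zero])
  rw [← sub_eq_iff_eq_add', exp_add_exp_neg_sub_two]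
  simp only [exponentMap]
  rw [eq_div_iff (pow_ne_zero 2 (mul_ne_zero hq0 hs))]
  -- Since θ = l/n and T = n r q(k), both sides of the characteristic equation contain the factor r²
  -- l; cancelling it removes the trivial root and the explicit n.
  have e1 : l / T ^ 2 * (q k * sinhc (θ / 2)) ^ 2 * (r ^ 2 * l) = θ ^ 2 * sinhc (θ / 2) ^ 2 := by
    rw [hTn, hln]
    field_simp
  have e2 : η * G (k, η) =
      β * (Complex.exp (l / 2) * sinhc (l / 2)) * G (k, η) * (r ^ 2 * l) := by
    conv_lhs => rw [show η * G (k, η) = (r ^ 2 * β * (Complex.exp l - 1)) * G (k, η) by rw [hη]]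
    rw [exp_sub_one_eq_sinhc]
    ring
  rw [← e1, e2]
  exact mul_left_inj' (mul_ne_zero (pow_ne_zero 2 hr) hl)

/-- A complex number with `ν + 1/ν` close to `2` is `exp (-θ)` with `θ` small. -/
lemma exists_log_of_add_inv {ν e : ℂ} {ρ : ℝ} (hν : ν ≠ 0) (h : ν + ν⁻¹ = 2 + e) (hρ : 0 ≤ ρ)
    (hρ4 : ρ ≤ 1 / 4) (he : ‖e‖ ≤ ρ ^ 2) :
    ∃ θ : ℂ, ν = Complex.exp (-θ) ∧ ‖θ‖ ≤ 3 * ρ := by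
  -- Near 2, ν + 1/ν has a double root at ν = 1, so a perturbation of size ρ² moves ν by O(ρ).
  have h1 : (ν - 1) ^ 2 = ν * e := by
    have h2 : ν * ν⁻¹ = 1 := mul_inv_cancel₀ hν
    linear_combination ν * h - h2
  set x : ℝ := ‖ν - 1‖ with hx
  have hx0 : 0 ≤ x := norm_nonneg _
  have h2 : x ^ 2 ≤ (1 + x) * ρ ^ 2 := by
    rw [hx, ← norm_pow, h1, norm_mul]
    gcongr
    calc ‖ν‖ = ‖1 + (ν - 1)‖ := by ring_nf
      _ ≤ ‖(1 : ℂ)‖ + ‖ν - 1‖ := norm_add_le _ _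
      _ = _ := by simp
  have h3 : x ≤ 2 * ρ := by
    by_contra! hc
    nlinarith [mul_nonneg hx0 hρ]
  have h4 : ‖Complex.log (1 + (ν - 1))‖ ≤ 3 / 2 * x :=
    Complex.norm_log_one_add_half_le_self (by rw [← hx]; linarith)
  refine ⟨-Complex.log (1 + (ν - 1)), ?_, ?_⟩
  · rw [neg_neg, Complex.exp_log] <;> ring_nf
    exact hν
  · rw [norm_neg]; linarith

lemma dist_pair_zero_lt {x y : ℂ} {δ : ℝ} (hx : ‖x‖ < δ) (hy : ‖y‖ < δ) :
    dist (x, y) (0, 0) < δ := by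
  rw [Prod.dist_eq]
  exact max_lt (by simpa using hx) (by simpa using hy)

set_option maxHeartbeats 1000000 in
/-- The solutions of the characteristic equation in a fixed disk: the trivial one, and one given by
an analytic exponent `M`. -/
theorem exists_multiplier_function (α : ℝ) (hβ : β ≠ 0) (hq : ContDiffAt ℂ ω q 0)
    (hG : ContDiffAt ℂ ω G (0, 0)) (hq0 : q 0 ≠ 0) (hG0 : G (0, 0) = -(q 0) ^ 2 / 3) :
    ∃ M : ℂ × ℂ → ℂ, ContDiffAt ℂ ω M (0, 0) ∧ M (0, 0) = -β / 3 ∧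
      ∀ R : ℝ, 1 < R → ∀ᶠ d in 𝓝[>] (0 : ℝ), ∀ r T : ℝ, 0 < r → r < d → 0 < T → T < d →
        ∀ n : ℕ, (T : ℂ) = n * r * q (r ^ 2 * α) →
          β * (M (r, T)).re < 0 ∧ ∃ ν₀ : ℂ, (ν₀ ^ n)⁻¹ = Complex.exp (T ^ 2 * M (r, T)) ∧
            ∀ ν : ℂ, ν ≠ 0 → ((‖(ν ^ n)⁻¹‖ ≤ R ∧ ν + ν⁻¹ =
              2 + (r ^ 2 * β * ((ν ^ n)⁻¹ - 1)) * G (r ^ 2 * α, r ^ 2 * β * ((ν ^ n)⁻¹ - 1))) ↔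
              ν = 1 ∨ ν = ν₀) := by
  obtain ⟨M, hM, hM0, hMiff⟩ := exists_exponent (α := α) (β := β) hq hG hq0 hG0
  refine ⟨M, hM, hM0, fun R hR => ?_⟩
  set m₀ : ℂ := -β / 3 with hm₀
  have hm₀n : ‖m₀‖ = |β| / 3 := by simp [hm₀]
  have hβ0 : 0 < |β| := abs_pos.2 hβ
  obtain ⟨δ₂, hδ₂, hδ₂'⟩ := Metric.eventually_nhds_iff.1 hMiff
  -- The bound by δ₂ keeps m where the implicit function is the unique solution; the bound by |β|/3
  -- keeps Re m on the side of -β.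
  set ρ : ℝ := min δ₂ (|β| / 3)
  have hρ : 0 < ρ := by positivity
  obtain ⟨δ₃, hδ₃, hM'⟩ := Metric.continuousAt_iff.1 hM.continuousAt ρ hρ
  set C : ℝ := ‖G (0, 0)‖ + 1
  have hΨ := (contDiffAt_exponentMap (β := β) hq hG hq0).continuousAt
  have hGc := hG.continuousAt
  have hsc : ContinuousAt (fun θ : ℂ => sinhc (θ / 2)) 0 :=
    (contDiff_sinhc.continuous.comp (continuous_id.div_const 2)).continuousAt
  obtain ⟨δ₄, hδ₄, hΨ'⟩ := Metric.continuousAt_iff.1 hΨ ρ hρ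
  obtain ⟨δ₅, hδ₅, hG'⟩ := Metric.continuousAt_iff.1 hGc 1 one_pos
  obtain ⟨δ₆, hδ₆, hs'⟩ := Metric.continuousAt_iff.1 hsc 1 one_pos
  obtain ⟨δ₇, hδ₇, hq'⟩ := Metric.continuousAt_iff.1 hq.continuousAt (‖q 0‖ / 2)
    (half_pos (norm_pos_iff.2 hq0))
  set δ₁ : ℝ := min (min δ₄ δ₅) (min δ₆ δ₇)
  have hδ₁ : 0 < δ₁ := by positivity
  have h14 : δ₁ ≤ δ₄ := (min_le_left _ _).trans (min_le_left _ _)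
  have h15 : δ₁ ≤ δ₅ := (min_le_left _ _).trans (min_le_right _ _)
  have h16 : δ₁ ≤ δ₆ := (min_le_right _ _).trans (min_le_left _ _)
  have h17 : δ₁ ≤ δ₇ := (min_le_right _ _).trans (min_le_right _ _)
  have hC : 0 < C := by positivity
  -- Chosen so that |η G| ≤ (c r)² whenever |σ| ≤ R.
  set c : ℝ := √(|β| * (R + 1) * C)
  have hc0 : 0 ≤ c := Real.sqrt_nonneg _
  have hc2 : c ^ 2 = |β| * (R + 1) * C := Real.sq_sqrt (by positivity)
  have small : ∀ (F : ℝ → ℝ) (b : ℝ), Continuous F → F 0 = 0 → 0 < b →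
      ∀ᶠ d in 𝓝[>] (0 : ℝ), F d < b := fun F b hF hF0 hb =>
    ((hF.tendsto' 0 0 hF0).mono_left nhdsWithin_le_nhds).eventually_lt_const hb
  filter_upwards [self_mem_nhdsWithin,
    small (fun d => d ^ 2 * |α|) δ₁ (by fun_prop) (by simp) hδ₁,
    small (fun d => d ^ 2 * |β| * (R + 1)) δ₁ (by fun_prop) (by simp) hδ₁,
    small (fun d => c * d) (1 / 4) (by fun_prop) (by simp) (by norm_num),
    small (fun d => 3 * (c * d)) δ₁ (by fun_prop) (by simp) hδ₁,
    small (fun d => 6 * c / ‖q 0‖ * d) δ₁ (by fun_prop) (by simp) hδ₁,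
    small (fun d => d) δ₂ (by fun_prop) (by simp) hδ₂,
    small (fun d => d) δ₃ (by fun_prop) (by simp) hδ₃,
    small (fun d => d ^ 2 * |β|) δ₁ (by fun_prop) (by simp) hδ₁,
    small (fun d => d ^ 2 * |β|) (Real.log R) (by fun_prop) (by simp) (Real.log_pos hR)]
    with d hd e1 e2 e3 e4 e5 e6 e7 e8 e9 r T hr hrd hT hTd n hTn
  have hd0 : 0 < d := hd
  set k : ℂ := (r : ℂ) ^ 2 * α with hk
  have hk1 : ‖k‖ < δ₁ := by
    have : ‖k‖ = r ^ 2 * |α| := by simp [hk]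
    rw [this]
    refine lt_of_le_of_lt ?_ e1
    gcongr
  have hqk : ‖q 0‖ / 2 < ‖q k‖ := by
    have h1 := hq' (x := k) (by rw [dist_zero_right]; exact hk1.trans_le h17)
    rw [dist_eq_norm] at h1
    have h2 := norm_sub_norm_le (q 0) (q k)
    rw [norm_sub_rev] at h2
    linarith
  have hr' : (r : ℂ) ≠ 0 := Complex.ofReal_ne_zero.2 hr.ne'
  have hT' : (T : ℂ) ≠ 0 := Complex.ofReal_ne_zero.2 hT.ne'
  have hqk0 : q k ≠ 0 := by rintro h; exact hT' (by rw [hTn, h, mul_zero])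
  have hn : (n : ℂ) ≠ 0 := by rintro h; exact hT' (by rw [hTn, h]; ring)
  have hn1 : 1 ≤ n := Nat.one_le_iff_ne_zero.2 (by exact_mod_cast hn)
  have hn1' : (1 : ℝ) ≤ n := by exact_mod_cast hn1
  have hη : ∀ σ : ℂ, ‖σ‖ ≤ R → ‖(r : ℂ) ^ 2 * β * (σ - 1)‖ ≤ r ^ 2 * (|β| * (R + 1)) := by
    intro σ hσ
    have h1 : ‖σ - 1‖ ≤ R + 1 := (norm_sub_le _ _).trans (by simpa using hσ)
    rw [norm_mul, norm_mul, norm_pow, Complex.norm_real, Complex.norm_real,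
      Real.norm_of_nonneg hr.le, Real.norm_eq_abs, mul_assoc]
    gcongr
  have hη' : ∀ σ : ℂ, ‖σ‖ ≤ R → ‖(r : ℂ) ^ 2 * β * (σ - 1)‖ < δ₁ := by
    intro σ hσ
    refine ((hη σ hσ).trans ?_).trans_lt e2
    rw [mul_assoc]
    gcongr
  have hrn : ‖(r : ℂ)‖ ≤ r := by rw [Complex.norm_real, Real.norm_of_nonneg hr.le]
  have hTn' : ‖(T : ℂ)‖ ≤ T := by rw [Complex.norm_real, Real.norm_of_nonneg hT.le]
  set m : ℂ := M (r, T) with hm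
  have hmd : dist m m₀ < ρ := by
    have := hM' (dist_pair_zero_lt (hrn.trans_lt (hrd.trans e7)) (hTn'.trans_lt (hTd.trans e7)))
    rwa [hM0] at this
  have hrT : ∀ y : ℂ, dist y m₀ < ρ → dist (((r : ℂ), (T : ℂ)), y) ((0, 0), m₀) < δ₂ := by
    intro y hy
    rw [Prod.dist_eq]
    refine max_lt ?_ (hy.trans_le (min_le_left _ _))
    exact dist_pair_zero_lt (hrn.trans_lt (hrd.trans e6)) (hTn'.trans_lt (hTd.trans e6))
  -- With y = l/T² one has θ = l/n = T y r q(k), so the arguments depend on n only through r and T.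
  have hargs : ∀ {θ l y : ℂ}, l = n * θ → y * T ^ 2 = l →
      exponentArgs α β q (((r : ℂ), (T : ℂ)), y) =
        ((k, θ), (l, r ^ 2 * β * (Complex.exp l - 1))) := by
    intro θ l y h1 h2
    have h3 : (T : ℂ) ^ 2 * y = l := by rw [mul_comm]; exact h2
    have h4 : (T : ℂ) * y * r * q k = θ := by
      have h5 : (n * r * q k) * (T * y * r * q k) = (n * r * q k) * θ := by
        rw [← hTn]
        linear_combination (r * q k) * h3 + (r * q k) * h1 - θ * hTn
      exact mul_left_cancel₀ (by rw [← hTn]; exact hT') h5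
    simp only [exponentArgs, h3, ← hk, h4]
  have hm2 : ‖m - m₀‖ < |β| / 3 := by
    rw [← dist_eq_norm]; exact hmd.trans_le (min_le_right _ _)
  have hmle : ‖m‖ ≤ |β| := by
    have := norm_add_le (m - m₀) m₀
    rw [sub_add_cancel] at this
    linarith
  have hmre : β * m.re < 0 := by
    have h1 : |m.re + β / 3| < |β| / 3 := by
      refine lt_of_le_of_lt ?_ hm2
      have h2 := Complex.abs_re_le_norm (m - m₀)
      have h3 : (m - m₀).re = m.re + β / 3 := by
        have h4 : m₀ = ((-β / 3 : ℝ) : ℂ) := by rw [hm₀]; push_cast; ring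
        rw [h4, Complex.sub_re, Complex.ofReal_re]; ring
      rwa [h3] at h2
    have h5 := abs_lt.1 h1
    rcases lt_or_gt_of_ne hβ with h | h
    · rw [abs_of_neg h] at h5; nlinarith
    · rw [abs_of_pos h] at h5; nlinarith
  have hm0 : m ≠ 0 := by rintro h; rw [h] at hmre; simp at hmre
  set l₀ : ℂ := m * T ^ 2 with hl₀
  set θ₀ : ℂ := l₀ / n with hθ₀
  have hlθ : l₀ = n * θ₀ := by rw [hθ₀]; field_simp
  have hl₀0 : l₀ ≠ 0 := mul_ne_zero hm0 (pow_ne_zero 2 hT')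
  have hl₀n : ‖l₀‖ ≤ T ^ 2 * |β| := by
    rw [hl₀, norm_mul, norm_pow, Complex.norm_real, Real.norm_of_nonneg hT.le, mul_comm]
    gcongr
  have hTd2 : T ^ 2 * |β| ≤ d ^ 2 * |β| := by gcongr
  have hθ₀n : ‖θ₀‖ ≤ ‖l₀‖ := by
    rw [hθ₀, norm_div, Complex.norm_natCast]
    exact div_le_self (norm_nonneg _) hn1'
  have hσ₀ : ‖Complex.exp l₀‖ ≤ R := by
    rw [Complex.norm_exp, ← Real.le_log_iff_exp_le (by linarith)]
    exact (Complex.re_le_norm _).trans (hl₀n.trans (hTd2.trans e9.le))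
  have hs : ∀ θ : ℂ, ‖θ‖ < δ₁ → sinhc (θ / 2) ≠ 0 := by
    intro θ hθ h0
    have := hs' (x := θ) (by rw [dist_zero_right]; exact hθ.trans_le h16)
    simp [h0, sinhc_zero] at this
  have hpow : ∀ θ : ℂ, (Complex.exp (-θ) ^ n)⁻¹ = Complex.exp (n * θ) := by
    intro θ
    rw [← Complex.exp_nat_mul, ← Complex.exp_neg]; ring_nf
  have hν₀ : (Complex.exp (-θ₀) ^ n)⁻¹ = Complex.exp l₀ := by rw [hpow, ← hlθ]
  refine ⟨hmre, Complex.exp (-θ₀), ?_, fun ν hν => ⟨?_, ?_⟩⟩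
  · rw [hν₀, hl₀, mul_comm]
  · rintro ⟨hσ, hchar⟩
    set σ : ℂ := (ν ^ n)⁻¹ with hσdef
    set η : ℂ := r ^ 2 * β * (σ - 1) with hηdef
    have hGb : ‖G (k, η)‖ ≤ C := by
      have h1 := hG' (dist_pair_zero_lt (hk1.trans_le h15) ((hη' σ hσ).trans_le h15))
      rw [dist_eq_norm] at h1
      have h2 := norm_sub_norm_le (G (k, η)) (G (0, 0))
      simp only [C]
      linarith
    have hcd : c * r ≤ c * d := by gcongr
    obtain ⟨θ, hθν, hθ⟩ := exists_log_of_add_inv (ρ := c * r) hν hchar (by positivity)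
      (hcd.trans e3.le) (by
        rw [norm_mul, mul_pow, hc2]
        calc ‖η‖ * ‖G (k, η)‖ ≤ (r ^ 2 * (|β| * (R + 1))) * C := by
              gcongr
              exact hη σ hσ
          _ = _ := by ring)
    have hθ1 : ‖θ‖ < δ₁ := hθ.trans_lt (lt_of_le_of_lt (by gcongr) e4)
    set l : ℂ := n * θ with hl
    have hσl : σ = Complex.exp l := by rw [hσdef, hθν, hpow]
    by_cases hl0 : l = 0
    · left
      have : θ = 0 := (mul_eq_zero.1 hl0).resolve_left hn
      rw [hθν, this]; simp
    right
    -- Although n may be large, n r is comparable to T because T = n r |q(k)| and |q(k)| > |q(0)|/2.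
    -- Thus |θ| ≤ 3 c r gives |l| ≤ 6 c T/|q(0)|.
    have hl1 : ‖l‖ < δ₁ := by
      refine lt_of_le_of_lt ?_ e5
      have h1 : (n : ℝ) * r * ‖q k‖ = T := by
        have := congrArg norm hTn
        rw [norm_mul, norm_mul, Complex.norm_natCast, Complex.norm_real, Complex.norm_real,
          Real.norm_of_nonneg hr.le, Real.norm_of_nonneg hT.le] at this
        exact this.symm
      have hq0' : 0 < ‖q 0‖ := norm_pos_iff.2 hq0
      have h2 : (n : ℝ) * r * ‖q 0‖ ≤ 2 * T := by
        rw [← h1]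
        have : 0 ≤ (n : ℝ) * r := by positivity
        nlinarith
      rw [hl, norm_mul, Complex.norm_natCast]
      calc (n : ℝ) * ‖θ‖ ≤ n * (3 * (c * r)) := by gcongr
        _ = 3 * c / ‖q 0‖ * (n * r * ‖q 0‖) := by field_simp
        _ ≤ 3 * c / ‖q 0‖ * (2 * T) := by gcongr
        _ = 6 * c / ‖q 0‖ * T := by ring
        _ ≤ 6 * c / ‖q 0‖ * d := by gcongr
    have hηl : η = r ^ 2 * β * (Complex.exp l - 1) := by rw [hηdef, hσl]
    have hchar' : Complex.exp θ + Complex.exp (-θ) = 2 + η * G (k, η) := by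
      rw [← hchar, hθν, ← Complex.exp_neg, neg_neg, add_comm]
    have hfix := (characteristic_iff n hr' hT' hl0 hTn hl (hs θ hθ1) hηl).1 hchar'
    have hΨd := hΨ' (x := ((k, θ), (l, η))) (by
      rw [Prod.dist_eq]
      exact max_lt (dist_pair_zero_lt (hk1.trans_le h14) (hθ1.trans_le h14))
        (dist_pair_zero_lt (hl1.trans_le h14) ((hη' σ hσ).trans_le h14)))
    -- The equation itself places l/T² close to -β/3, since the right-hand side is continuous at
    -- small arguments. Only then can local uniqueness be used.
    rw [exponentMap_zero hq0 hG0, ← hfix] at hΨd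
    have hy : l / (T : ℂ) ^ 2 * T ^ 2 = l := div_mul_cancel₀ _ (pow_ne_zero 2 hT')
    have hlm := (hδ₂' (hrT _ hΨd)).1 (by
      change l / (T : ℂ) ^ 2 = _
      rw [hargs hl hy, ← hηl]; exact hfix)
    change m = l / (T : ℂ) ^ 2 at hlm
    rw [hθν, hθ₀, hl₀, hlm, hy, hl, mul_div_cancel_left₀ _ hn]
  · rintro (rfl | rfl)
    · simp [hR.le]; norm_num
    · rw [hν₀]
      refine ⟨hσ₀, ?_⟩
      have hθ1 : ‖θ₀‖ < δ₁ := hθ₀n.trans_lt (hl₀n.trans_lt (hTd2.trans_lt e8))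
      rw [← Complex.exp_neg, neg_neg, add_comm]
      rw [characteristic_iff n hr' hT' hl₀0 hTn hlθ (hs θ₀ hθ1) rfl, ← hargs hlθ hl₀.symm]
      have h := (hδ₂' (hrT m hmd)).2 rfl
      rw [hl₀, mul_div_cancel_right₀ _ (pow_ne_zero 2 hT')]
      exact h

end Exponent

/-! ### The Duffing orbit in the angle variable. -/

/-- Solutions on the line of a planar linear system with vanishing initial data vanish. -/
lemma planar_linear_eq_zero_univ {p q w v : ℝ → ℂ} (hp : Continuous p) (hq : Continuous q)
    (hw : ∀ t, HasDerivAt w (p t * v t) t) (hv : ∀ t, HasDerivAt v (q t * w t) t)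
    (hw0 : w 0 = 0) (hv0 : v 0 = 0) (t : ℝ) : w t = 0 ∧ v t = 0 := by
  rcases le_total 0 t with ht | ht
  · exact planar_linear_eq_zero hp.continuousOn hq.continuousOn
      (fun s _ => (hw s).hasDerivWithinAt) (fun s _ => (hv s).hasDerivWithinAt) hw0 hv0 t
      (right_mem_Icc.2 ht)
  -- Time reversal: changing the sign of the second component compensates for one of the two signs,
  -- and the reversed system keeps the same form.
  · have h := planar_linear_eq_zero (L := -t) (p := fun s => p (-s)) (q := fun s => q (-s))
      (w := fun s => w (-s)) (v := fun s => -v (-s)) (by fun_prop) (by fun_prop)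
      (fun s _ => ?_) (fun s _ => ?_) (by simpa using hw0) (by simpa using hv0) (-t)
      (right_mem_Icc.2 (by linarith))
    · simpa using h
    · have := (hw (-s)).scomp s (hasDerivAt_neg s)
      refine HasDerivAt.hasDerivWithinAt (this.congr_deriv ?_)
      simp
    · have := ((hv (-s)).scomp s (hasDerivAt_neg s)).neg
      refine HasDerivAt.hasDerivWithinAt (this.congr_deriv ?_)
      simp

/-- The rescaled time as a function of the angle. -/
noncomputable def angleTime (k φ : ℝ) : ℝ := ∫ ψ in (0 : ℝ)..φ, (angleSpeed k ψ)⁻¹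

section AngleTime

variable {k : ℝ}

lemma angleTime_zero (k : ℝ) : angleTime k 0 = 0 := by simp [angleTime]

lemma angleTime_pi (k : ℝ) : angleTime k Real.pi = halfPeriod k := rfl

lemma angleTime_add_pi (hk : -(1 / 2) < k) (φ : ℝ) :
    angleTime k (φ + Real.pi) = angleTime k φ + halfPeriod k := by
  have hper : Function.Periodic (fun φ => (angleSpeed k φ)⁻¹) Real.pi := fun φ => by
    simp only [angleSpeed_periodic k φ]
  have hi := fun a b => (continuous_inv_angleSpeed hk).intervalIntegrable (μ := MeasureTheory.volume) a b
  have h := hper.intervalIntegral_add_eq φ 0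
  rw [zero_add] at h
  rw [angleTime, angleTime, halfPeriod, ← h,
    intervalIntegral.integral_add_adjacent_intervals (hi _ _) (hi _ _)]

lemma strictMono_angleTime (hk : -(1 / 2) < k) : StrictMono (angleTime k) :=
  strictMono_of_hasDerivAt_pos (fun φ => hasDerivAt_angleTime hk φ)
    (fun φ => inv_pos.2 (angleSpeed_pos hk φ))

lemma continuous_angleTime (hk : -(1 / 2) < k) : Continuous (angleTime k) :=
  continuous_iff_continuousAt.2 fun φ => (hasDerivAt_angleTime hk φ).continuousAt

lemma surjective_angleTime (hk : -(1 / 2) < k) : Function.Surjective (angleTime k) := by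
  have hper : Function.Periodic (fun φ => (angleSpeed k φ)⁻¹) Real.pi := fun φ => by
    simp only [angleSpeed_periodic k φ]
  have hi := fun a b => (continuous_inv_angleSpeed hk).intervalIntegrable (μ := MeasureTheory.volume) a b
  have hpos : 0 < ∫ φ in (0 : ℝ)..Real.pi, (angleSpeed k φ)⁻¹ := halfPeriod_pos hk
  exact (continuous_angleTime hk).surjective
    (hper.tendsto_atTop_intervalIntegral_of_pos hpos Real.pi_pos)
    (hper.tendsto_atBot_intervalIntegral_of_pos hpos Real.pi_pos)

/-- The inverse of `φ ↦ r τ(φ)`: the angle as a function of time. -/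
lemma exists_angle (hk : -(1 / 2) < k) {r : ℝ} (hr : 0 < r) : ∃ Φ : ℝ → ℝ,
    (∀ t, r * angleTime k (Φ t) = t) ∧ (∀ φ, Φ (r * angleTime k φ) = φ) ∧
    ∀ t, HasDerivAt Φ (angleSpeed k (Φ t) / r) t := by
  have hmono : StrictMono fun φ => r * angleTime k φ := (strictMono_angleTime hk).const_mul hr
  have hsurj : Function.Surjective fun φ => r * angleTime k φ := fun t => by
    obtain ⟨φ, hφ⟩ := surjective_angleTime hk (t / r)
    exact ⟨φ, by simp only [hφ]; field_simp⟩
  let e := hmono.orderIsoOfSurjective _ hsurj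
  have h1 : ∀ t, r * angleTime k (e.symm t) = t := fun t => e.apply_symm_apply t
  refine ⟨e.symm, h1, fun φ => e.symm_apply_apply φ, fun t => ?_⟩
  have h := HasDerivAt.of_local_left_inverse (a := t) (f := fun φ => r * angleTime k φ)
    (g := e.symm) e.symm.continuous.continuousAt ((hasDerivAt_angleTime hk (e.symm t)).const_mul r)
    (mul_ne_zero hr.ne' (inv_ne_zero (angleSpeed_pos hk _).ne')) (Filter.Eventually.of_forall h1)
  refine h.congr_deriv ?_
  rw [mul_inv, inv_inv, div_eq_inv_mul]

end AngleTime

namespace IsDuffingOrbit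

variable {α A p k r : ℝ} {x : ℝ → ℝ}

lemma continuous (hx : IsDuffingOrbit α A p x) : Continuous x :=
  continuous_iff_continuousAt.2 fun t => (hx.hasDerivAt t).continuousAt

/-- The orbit in the angle variable. -/
lemma angle (hx : IsDuffingOrbit α A p x) (hr : r * A = 1) (hkα : k = r ^ 2 * α)
    (hk : -(1 / 2) < k) (φ : ℝ) : r * x (r * angleTime k φ) = Real.cos φ ∧
      r ^ 2 * deriv x (r * angleTime k φ) = -(Real.sin φ * angleSpeed k φ) := by
  have hτ := fun φ => (hasDerivAt_angleTime hk φ).const_mul r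
  have hX : ∀ φ, HasDerivAt (fun φ => x (r * angleTime k φ))
      (deriv x (r * angleTime k φ) * (r * (angleSpeed k φ)⁻¹)) φ := fun φ =>
    (hx.hasDerivAt _).comp φ (hτ φ)
  have hX' : ∀ φ, HasDerivAt (fun φ => deriv x (r * angleTime k φ))
      ((-α * x (r * angleTime k φ) - x (r * angleTime k φ) ^ 3) * (r * (angleSpeed k φ)⁻¹)) φ :=
    fun φ => (hx.hasDerivAt_deriv _).comp φ (hτ φ)
  have hU : ∀ φ, HasDerivAt (fun φ => r * x (r * angleTime k φ) - Real.cos φ)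
      ((angleSpeed k φ)⁻¹ * (r ^ 2 * deriv x (r * angleTime k φ) + Real.sin φ * angleSpeed k φ))
      φ := by
    intro φ
    refine (((hX φ).const_mul r).sub (Real.hasDerivAt_cos φ)).congr_deriv ?_
    have := (angleSpeed_pos hk φ).ne'
    field_simp
    ring
  -- The deviations of the orbit from cos φ and -sin φ · P satisfy a linear planar system with zero
  -- initial data, because x³ - cos³ factors (after rescaling). Uniqueness for linear systems
  -- therefore suffices.
  have hV : ∀ φ, HasDerivAt
      (fun φ => r ^ 2 * deriv x (r * angleTime k φ) + Real.sin φ * angleSpeed k φ)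
      (-((angleSpeed k φ)⁻¹ * (k + (r * x (r * angleTime k φ)) ^ 2 +
        r * x (r * angleTime k φ) * Real.cos φ + Real.cos φ ^ 2)) *
        (r * x (r * angleTime k φ) - Real.cos φ)) φ := by
    intro φ
    refine (((hX' φ).const_mul (r ^ 2)).add (hasDerivAt_sin_mul_angleSpeed hk φ)).congr_deriv ?_
    rw [hkα]
    ring
  have hxc := hx.continuous
  have hτc := continuous_angleTime hk
  have hPc := continuous_inv_angleSpeed hk
  have key := planar_linear_eq_zero_univ (p := fun φ => (((angleSpeed k φ)⁻¹ : ℝ) : ℂ))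
    (q := fun φ => ((-((angleSpeed k φ)⁻¹ * (k + (r * x (r * angleTime k φ)) ^ 2 +
        r * x (r * angleTime k φ) * Real.cos φ + Real.cos φ ^ 2)) : ℝ) : ℂ))
    (w := fun φ => ((r * x (r * angleTime k φ) - Real.cos φ : ℝ) : ℂ))
    (v := fun φ => ((r ^ 2 * deriv x (r * angleTime k φ) + Real.sin φ * angleSpeed k φ : ℝ) : ℂ))
    (Complex.continuous_ofReal.comp hPc) (Complex.continuous_ofReal.comp (by fun_prop))
    (fun t => by simpa only [Complex.ofReal_mul] using (hU t).ofReal_comp)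
    (fun t => by simpa only [Complex.ofReal_mul] using (hV t).ofReal_comp)
    (by simp [angleTime_zero, hx.initial, hr])
    (by simp [angleTime_zero, hx.initial_deriv]) φ
  constructor
  · linarith [Complex.ofReal_eq_zero.1 key.1]
  · linarith [Complex.ofReal_eq_zero.1 key.2]

/-- Advancing the angle by π changes the sign of cos and sin, leaves the speed unchanged and takes
the time r q(k). -/
lemma antiperiodic (hx : IsDuffingOrbit α A p x) (hr : r * A = 1) (hkα : k = r ^ 2 * α)
    (hk : -(1 / 2) < k) (t : ℝ) : x (t + r * halfPeriod k) = -x t ∧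
      deriv x (t + r * halfPeriod k) = -deriv x t := by
  have hr0 : 0 < r := by
    have := hx.amplitude_pos
    by_contra! h
    nlinarith
  obtain ⟨φ, hφ⟩ := surjective_angleTime hk (t / r)
  have ht : t = r * angleTime k φ := by rw [hφ]; field_simp
  have ht' : t + r * halfPeriod k = r * angleTime k (φ + Real.pi) := by
    rw [angleTime_add_pi hk, ht]; ring
  have h1 := hx.angle hr hkα hk φ
  have h2 := hx.angle hr hkα hk (φ + Real.pi)
  rw [← ht', Real.cos_add_pi, Real.sin_add_pi, angleSpeed_periodic k φ] at h2
  rw [← ht] at h1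
  constructor
  · exact mul_left_cancel₀ hr0.ne' (by linarith)
  · exact mul_left_cancel₀ (pow_ne_zero 2 hr0.ne') (by linarith)

/-- Two antiperiods form a period, which bounds p from above. Conversely x(p) = A means cos φ = 1 at
the corresponding angle φ > 0, hence φ ≥ 2π. -/
lemma period_eq (hx : IsDuffingOrbit α A p x) (hr : r * A = 1) (hkα : k = r ^ 2 * α)
    (hk : -(1 / 2) < k) : p = 2 * (r * halfPeriod k) := by
  have hA := hx.amplitude_pos
  have hr0 : 0 < r := by
    by_contra! h
    nlinarith
  have hq := halfPeriod_pos hk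
  refine le_antisymm (hx.period_minimal _ (by positivity) fun t => ?_) ?_
  · rw [two_mul, ← add_assoc, (hx.antiperiodic hr hkα hk _).1, (hx.antiperiodic hr hkα hk _).1,
      neg_neg]
  · obtain ⟨φ, hφ⟩ := surjective_angleTime hk (p / r)
    have hp : p = r * angleTime k φ := by rw [hφ]; field_simp
    have hφ0 : 0 < φ := by
      rw [← (strictMono_angleTime hk).lt_iff_lt, angleTime_zero, hφ]
      exact div_pos hx.period_pos hr0
    have h1 := (hx.angle hr hkα hk φ).1
    have h2 : x p = A := by
      have := hx.periodic 0
      rw [zero_add] at this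
      rw [this, hx.initial]
    rw [← hp, h2, hr] at h1
    obtain ⟨j, hj⟩ := (Real.cos_eq_one_iff φ).1 h1.symm
    have hj1 : (1 : ℝ) ≤ j := by
      have : 0 < j := by
        by_contra! hc
        have : (j : ℝ) ≤ 0 := by exact_mod_cast hc
        nlinarith [Real.pi_pos]
      exact_mod_cast this
    have h3 : Real.pi + Real.pi ≤ φ := by nlinarith [Real.pi_pos]
    have h4 := (strictMono_angleTime hk).monotone h3
    rw [angleTime_add_pi hk, angleTime_pi] at h4
    rw [hp]
    nlinarith

end IsDuffingOrbit

/-! ### Floquet extension and the passage between angle and time. -/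

/-- The extension to the line of a function on `[0, π]` with `f(φ + π) = ν f(φ)`. -/
noncomputable def floquetExtend (ν : ℂ) (f : ℝ → ℂ) (φ : ℝ) : ℂ :=
  ν ^ ⌊φ / Real.pi⌋ * f (φ - ⌊φ / Real.pi⌋ * Real.pi)

section FloquetExtend

variable {ν : ℂ} {f d : ℝ → ℂ}

lemma floquetExtend_add_pi (hν : ν ≠ 0) (f : ℝ → ℂ) (φ : ℝ) :
    floquetExtend ν f (φ + Real.pi) = ν * floquetExtend ν f φ := by
  have h : (φ + Real.pi) / Real.pi = φ / Real.pi + 1 := by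
    rw [add_div, div_self Real.pi_ne_zero]
  rw [floquetExtend, floquetExtend, h, Int.floor_add_one, zpow_add_one₀ hν]
  push_cast
  ring_nf

lemma floquetExtend_of_mem_Ico {φ : ℝ} (hφ : φ ∈ Ico 0 Real.pi) : floquetExtend ν f φ = f φ := by
  have h : ⌊φ / Real.pi⌋ = 0 := by
    rw [Int.floor_eq_zero_iff]
    exact ⟨div_nonneg hφ.1 Real.pi_pos.le, (div_lt_one Real.pi_pos).2 hφ.2⟩
  simp [floquetExtend, h]

lemma floquetExtend_of_mem (hν : ν ≠ 0) (hf : f Real.pi = ν * f 0) {φ : ℝ}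
    (hφ : φ ∈ Icc 0 Real.pi) : floquetExtend ν f φ = f φ := by
  rcases hφ.2.lt_or_eq with h | h
  · exact floquetExtend_of_mem_Ico ⟨hφ.1, h⟩
  · have h1 := floquetExtend_add_pi hν f 0
    rw [zero_add, floquetExtend_of_mem_Ico ⟨le_rfl, Real.pi_pos⟩] at h1
    rw [h, h1, hf]

lemma floquetExtend_add_int_mul_pi (hν : ν ≠ 0) (f : ℝ → ℂ) (j : ℤ) (φ : ℝ) :
    floquetExtend ν f (φ + j * Real.pi) = ν ^ j * floquetExtend ν f φ := by
  have h : (φ + j * Real.pi) / Real.pi = φ / Real.pi + j := by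
    rw [add_div, mul_div_cancel_right₀ _ Real.pi_ne_zero]
  rw [floquetExtend, floquetExtend, h, Int.floor_add_intCast, zpow_add₀ hν]
  push_cast
  ring_nf

/-- The only critical angles are multiples of π. There the one-sided derivatives agree because d
obeys the same boundary condition as f; all other angles are translated into (0, π]. -/
lemma hasDerivAt_floquetExtend (hν : ν ≠ 0)
    (hfd : ∀ φ ∈ Icc 0 Real.pi, HasDerivWithinAt f (d φ) (Icc 0 Real.pi) φ)
    (hf : f Real.pi = ν * f 0) (hd : d Real.pi = ν * d 0) (φ : ℝ) :
    HasDerivAt (floquetExtend ν f) (floquetExtend ν d φ) φ := by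
  have hpi := Real.pi_pos
  have h0 : ∀ φ ∈ Icc 0 Real.pi,
      HasDerivWithinAt (floquetExtend ν f) (floquetExtend ν d φ) (Icc 0 Real.pi) φ := by
    intro φ hφ
    rw [floquetExtend_of_mem hν hd hφ]
    exact (hfd φ hφ).congr (fun ψ hψ => floquetExtend_of_mem hν hf hψ)
      (floquetExtend_of_mem hν hf hφ)
  have h1 : ∀ φ ∈ Ioc 0 Real.pi, HasDerivAt (floquetExtend ν f) (floquetExtend ν d φ) φ := by
    intro φ hφ
    rcases hφ.2.lt_or_eq with h | rfl
    · exact (h0 φ (Ioc_subset_Icc_self hφ)).hasDerivAt (Icc_mem_nhds hφ.1 h)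
    · have hr : HasDerivWithinAt (floquetExtend ν f) (floquetExtend ν d Real.pi)
          (Icc Real.pi (2 * Real.pi)) Real.pi := by
        have h2 : HasDerivWithinAt (floquetExtend ν f) (floquetExtend ν d (Real.pi - Real.pi))
            (Icc 0 Real.pi) ((fun ψ => ψ - Real.pi) Real.pi) := by
          simpa using h0 0 (left_mem_Icc.2 hpi.le)
        have h3 := (HasDerivWithinAt.scomp (h := fun ψ => ψ - Real.pi) Real.pi h2
          (((hasDerivAt_id Real.pi).sub_const Real.pi).hasDerivWithinAt (s := Icc Real.pi (2 * Real.pi)))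
          (fun ψ hψ => ⟨sub_nonneg.2 hψ.1, by linarith [hψ.2]⟩)).const_mul ν
        have e : ∀ (g : ℝ → ℂ) ψ, floquetExtend ν g ψ = ν * floquetExtend ν g (ψ - Real.pi) := by
          intro g ψ
          rw [← floquetExtend_add_pi hν, sub_add_cancel]
        refine (h3.congr (fun ψ _ => e f ψ) (e f _)).congr_deriv ?_
        rw [e d Real.pi, one_smul]
      refine ((h0 Real.pi (right_mem_Icc.2 hpi.le)).union hr).hasDerivAt ?_
      rw [Icc_union_Icc_eq_Icc hpi.le (by linarith)]
      exact Icc_mem_nhds hpi (by linarith)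
  obtain ⟨j, hj, -⟩ := existsUnique_add_zsmul_mem_Ioc hpi φ 0
  rw [zero_add, zsmul_eq_mul] at hj
  have e : ∀ (g : ℝ → ℂ) ψ,
      floquetExtend ν g ψ = (ν ^ j)⁻¹ * floquetExtend ν g (ψ + j * Real.pi) := by
    intro g ψ
    rw [floquetExtend_add_int_mul_pi hν, inv_mul_cancel_left₀ (zpow_ne_zero j hν)]
  have h2 := ((HasDerivAt.scomp φ (h1 _ hj) ((hasDerivAt_id φ).add_const _))).const_mul (ν ^ j)⁻¹
  refine (h2.congr_of_eventuallyEq (Filter.Eventually.of_forall fun ψ => e f ψ)).congr_deriv ?_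
  conv_rhs => rw [e d]
  simp

end FloquetExtend

section TimeChange

variable {α A p k r : ℝ} {x : ℝ → ℝ}

/-- Solutions of the linearization with constant extra term `μ` are Hill solutions in the angle. -/
lemma IsDuffingOrbit.hillSolution (hx : IsDuffingOrbit α A p x) (hr : r * A = 1)
    (hkα : k = r ^ 2 * α) (hk : -(1 / 2) < k) {μ : ℂ} {y y' : ℝ → ℂ}
    (hy : ∀ t ∈ Icc 0 (r * halfPeriod k), HasDerivWithinAt y (y' t) (Icc 0 (r * halfPeriod k)) t)
    (hy' : ∀ t ∈ Icc 0 (r * halfPeriod k), HasDerivWithinAt y'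
      (-(α + μ + 3 * (x t : ℂ) ^ 2) * y t) (Icc 0 (r * halfPeriod k)) t) :
    HillSolution k (r ^ 2 * μ) (Icc 0 Real.pi) (fun φ => y (r * angleTime k φ))
      (fun φ => r * y' (r * angleTime k φ)) := by
  have hr0 : 0 < r := by
    have := hx.amplitude_pos
    by_contra! h
    nlinarith
  have hτ : ∀ φ, HasDerivWithinAt (fun φ => r * angleTime k φ) (r * (angleSpeed k φ)⁻¹)
      (Icc 0 Real.pi) φ := fun φ => ((hasDerivAt_angleTime hk φ).const_mul r).hasDerivWithinAt
  have hm : MapsTo (fun φ => r * angleTime k φ) (Icc 0 Real.pi) (Icc 0 (r * halfPeriod k)) := by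
    intro φ hφ
    have h1 := (strictMono_angleTime hk).monotone hφ.1
    have h2 := (strictMono_angleTime hk).monotone hφ.2
    rw [angleTime_zero] at h1
    rw [angleTime_pi] at h2
    exact ⟨by positivity, by dsimp only; gcongr⟩
  refine ⟨fun φ hφ => ?_, fun φ hφ => ?_⟩
  · refine (HasDerivWithinAt.scomp φ (hy _ (hm hφ)) (hτ φ) hm).congr_deriv ?_
    rw [Complex.real_smul]
    push_cast
    ring
  · refine ((HasDerivWithinAt.scomp φ (hy' _ (hm hφ)) (hτ φ) hm).const_mul (r : ℂ)).congr_deriv ?_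
    have h1 : (r : ℂ) * x (r * angleTime k φ) = Real.cos φ := by
      exact_mod_cast (hx.angle hr hkα hk φ).1
    rw [Complex.real_smul, ← h1, hkα]
    push_cast
    ring

/-- A Hill solution on `[0, π]` with Floquet boundary condition yields a Floquet solution in time. -/
lemma IsDuffingOrbit.exists_floquet (hx : IsDuffingOrbit α A p x) (hr : r * A = 1)
    (hkα : k = r ^ 2 * α) (hk : -(1 / 2) < k) {μ ν : ℂ} (hν : ν ≠ 0) {w v : ℝ → ℂ}
    (h : HillSolution k (r ^ 2 * μ) (Icc 0 Real.pi) w v) (hw : w Real.pi = ν * w 0)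
    (hv : v Real.pi = ν * v 0) : ∃ y y' : ℝ → ℂ, (∀ t, HasDerivAt y (y' t) t) ∧
      (∀ t, HasDerivAt y' (-(α + μ + 3 * (x t : ℂ) ^ 2) * y t) t) ∧
      (∀ t, y (t + r * halfPeriod k) = ν * y t) ∧ (∀ t, y' (t + r * halfPeriod k) = ν * y' t) ∧
      y 0 = w 0 ∧ r * y' 0 = v 0 := by
  have hr0 : 0 < r := by
    have := hx.amplitude_pos
    by_contra! h
    nlinarith
  have hrC : (r : ℂ) ≠ 0 := Complex.ofReal_ne_zero.2 hr0.ne'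
  obtain ⟨Φ, hΦ1, hΦ2, hΦ⟩ := exists_angle hk hr0
  have hΦπ : ∀ t, Φ (t + r * halfPeriod k) = Φ t + Real.pi := by
    intro t
    rw [← hΦ2 (Φ t + Real.pi), angleTime_add_pi hk, mul_add, hΦ1]
  have hΦ0 : Φ 0 = 0 := by simpa [angleTime_zero] using hΦ2 0
  have hspeed : angleSpeed k Real.pi = angleSpeed k 0 := by
    simpa using angleSpeed_periodic k 0
  have hW := hasDerivAt_floquetExtend hν h.fst hw (by rw [hspeed, hv]; ring)
  have hV := hasDerivAt_floquetExtend hν h.snd hv (by rw [hspeed, hw]; simp; ring)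
  have e1 : ∀ φ, floquetExtend ν (fun φ => (((angleSpeed k φ)⁻¹ : ℝ) : ℂ) * v φ) φ =
      (((angleSpeed k φ)⁻¹ : ℝ) : ℂ) * floquetExtend ν v φ := by
    intro φ
    rw [floquetExtend, floquetExtend, (angleSpeed_periodic k).sub_int_mul_eq]
    ring
  have e2 : ∀ φ, floquetExtend ν (fun φ => -(k + r ^ 2 * μ + 3 * (Real.cos φ : ℂ) ^ 2) *
      ((angleSpeed k φ)⁻¹ : ℝ) * w φ) φ = -(k + r ^ 2 * μ + 3 * (Real.cos φ : ℂ) ^ 2) *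
      ((angleSpeed k φ)⁻¹ : ℝ) * floquetExtend ν w φ := by
    intro φ
    have hc : Function.Periodic (fun φ => Real.cos φ ^ 2) Real.pi := fun φ => by
      simp [Real.cos_add_pi]
    have hc' : (Real.cos (φ - ⌊φ / Real.pi⌋ * Real.pi) : ℂ) ^ 2 = (Real.cos φ : ℂ) ^ 2 := by
      have := hc.sub_int_mul_eq (x := φ) ⌊φ / Real.pi⌋
      exact_mod_cast this
    rw [floquetExtend, floquetExtend, (angleSpeed_periodic k).sub_int_mul_eq, hc']
    ring
  refine ⟨fun t => floquetExtend ν w (Φ t), fun t => (r : ℂ)⁻¹ * floquetExtend ν v (Φ t),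
    fun t => ?_, fun t => ?_, fun t => ?_, fun t => ?_, ?_, ?_⟩
  · have hP : (angleSpeed k (Φ t) : ℂ) ≠ 0 := Complex.ofReal_ne_zero.2 (angleSpeed_pos hk _).ne'
    refine ((hW (Φ t)).scomp t (hΦ t)).congr_deriv ?_
    rw [e1, Complex.real_smul]
    push_cast
    field_simp
  · have hP : (angleSpeed k (Φ t) : ℂ) ≠ 0 := Complex.ofReal_ne_zero.2 (angleSpeed_pos hk _).ne'
    refine (((hV (Φ t)).scomp t (hΦ t)).const_mul (r : ℂ)⁻¹).congr_deriv ?_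
    have h1 : (r : ℂ) * x t = Real.cos (Φ t) := by
      have := (hx.angle hr hkα hk (Φ t)).1
      rw [hΦ1] at this
      exact_mod_cast this
    have hkC : (k : ℂ) = r ^ 2 * α := by rw [hkα]; push_cast; ring
    rw [e2, Complex.real_smul, ← h1, hkC]
    push_cast
    field_simp
  · simp only [hΦπ, floquetExtend_add_pi hν]
  · simp only [hΦπ, floquetExtend_add_pi hν]; ring
  · simp only [hΦ0]
    exact floquetExtend_of_mem_Ico ⟨le_rfl, Real.pi_pos⟩
  · simp only [hΦ0]
    rw [floquetExtend_of_mem_Ico ⟨le_rfl, Real.pi_pos⟩]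
    field_simp

end TimeChange

/-! ### Floquet solutions of the delay equation and multipliers. -/

lemma HasDerivWithinAt.fst_comp {z : ℝ → ℂ × ℂ} {z' : ℂ × ℂ} {D : Set ℝ} {t : ℝ}
    (h : HasDerivWithinAt z z' D t) : HasDerivWithinAt (fun t => (z t).1) z'.1 D t :=
  (ContinuousLinearMap.fst ℝ ℂ ℂ).hasFDerivAt.comp_hasDerivWithinAt t h

lemma HasDerivWithinAt.snd_comp {z : ℝ → ℂ × ℂ} {z' : ℂ × ℂ} {D : Set ℝ} {t : ℝ}
    (h : HasDerivWithinAt z z' D t) : HasDerivWithinAt (fun t => (z t).2) z'.2 D t :=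
  (ContinuousLinearMap.snd ℝ ℂ ℂ).hasFDerivAt.comp_hasDerivWithinAt t h

namespace IsLinearizedSolution

variable {a b T h : ℝ} {x : ℝ → ℝ} {z w : ℝ → ℂ × ℂ} {n : ℕ} {ν : ℂ}

lemma add (hz : IsLinearizedSolution a b T x z) (hw : IsLinearizedSolution a b T x w) :
    IsLinearizedSolution a b T x (fun t => z t + w t) := by
  refine ⟨hz.continuousOn.add hw.continuousOn, fun t ht => ?_⟩
  refine ((hz.hasDerivWithinAt t ht).add (hw.hasDerivWithinAt t ht)).congr_deriv ?_
  ext <;> simp; ring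

lemma const_smul (hz : IsLinearizedSolution a b T x z) (c : ℂ) :
    IsLinearizedSolution a b T x (fun t => c • z t) := by
  refine ⟨hz.continuousOn.const_smul c, fun t ht => ?_⟩
  refine ((hz.hasDerivWithinAt t ht).const_smul c).congr_deriv ?_
  ext <;> simp; ring

/-- The orbit enters the linearization only through its square, so the equation is already invariant
under the half period. -/
lemma shift (hz : IsLinearizedSolution a b T x z) (hh : 0 ≤ h)
    (hx : ∀ t, x (t + h) ^ 2 = x t ^ 2) : IsLinearizedSolution a b T x (fun t => z (t + h)) := by
  refine ⟨hz.continuousOn.comp (by fun_prop) fun t ht => ?_, fun t ht => ?_⟩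
  · have : -T ≤ t := ht
    exact mem_Ici.2 (by linarith)
  · have h1 := HasDerivWithinAt.scomp (h := fun t => t + h) t (hz.hasDerivWithinAt (t + h) (by linarith))
      (((hasDerivAt_id t).add_const h).hasDerivWithinAt (s := Ici 0))
      (fun s hs => mem_Ici.2 (add_nonneg hs hh))
    refine h1.congr_deriv ?_
    rw [one_smul]
    have h2 : ((x (t + h) : ℝ) : ℂ) ^ 2 = (x t : ℂ) ^ 2 := by exact_mod_cast hx t
    have h3 : t + h - T = t - T + h := by ring
    rw [h2, h3]

lemma conj (hz : IsLinearizedSolution a b T x z) :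
    IsLinearizedSolution a b T x (fun t => star (z t)) := by
  refine ⟨hz.continuousOn.star, fun t ht => ?_⟩
  refine ((hz.hasDerivWithinAt t ht).star).congr_deriv ?_
  ext <;> simp

/-- Iteration of the Floquet condition through the delay interval. -/
lemma floquet_iterate (hT : T = n * h) (hh : 0 < h)
    (hfl : ∀ θ ∈ Icc (-T) 0, z (h + θ) = ν • z θ) {t : ℝ} (ht : t ∈ Icc 0 h) :
    ∀ j : ℕ, j ≤ n → z (t - T + j * h) = ν ^ j • z (t - T) := by
  intro j
  induction j with
  | zero => intro _; simp
  | succ j ih =>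
    intro hj
    have hj' : (j : ℝ) + 1 ≤ n := by exact_mod_cast hj
    have h1 := hfl (t - T + j * h) ⟨?_, ?_⟩
    · rw [ih (by omega), smul_smul, ← pow_succ'] at h1
      rw [← h1]
      congr 1
      push_cast; ring
    · have : 0 ≤ (j : ℝ) * h := by positivity
      linarith [ht.1]
    · rw [hT]
      nlinarith [ht.2]

/-- The delay is an exact multiple of h, so for a Floquet solution it is only a scalar factor. This
reduces the infinite-dimensional eigenvalue problem to an ordinary differential equation. -/
lemma floquet_delay (hT : T = n * h) (hh : 0 < h)
    (hfl : ∀ θ ∈ Icc (-T) 0, z (h + θ) = ν • z θ) {t : ℝ} (ht : t ∈ Icc 0 h) :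
    z t = ν ^ n • z (t - T) := by
  rw [← floquet_iterate hT hh hfl ht n le_rfl]
  congr 1
  linarith

lemma exists_decomposition (hT : T = n * h) (hh : 0 < h) {θ : ℝ} (hθ : θ ∈ Icc (-T) 0) :
    ∃ t ∈ Icc 0 h, ∃ j : ℕ, j ≤ n ∧ θ = t - T + j * h := by
  have h0 : 0 ≤ (θ + T) / h := div_nonneg (by linarith [hθ.1]) hh.le
  have h1 := Nat.floor_le h0
  have h2 := Nat.lt_floor_add_one ((θ + T) / h)
  rw [le_div_iff₀ hh] at h1
  rw [div_lt_iff₀ hh] at h2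
  refine ⟨θ + T - ⌊(θ + T) / h⌋₊ * h, ⟨by linarith, by linarith⟩, _, ?_, by ring⟩
  have h3 : (⌊(θ + T) / h⌋₊ : ℝ) * h ≤ n * h := by linarith [hθ.2]
  exact_mod_cast le_of_mul_le_mul_right h3 hh

/-- On `[0, h]` a Floquet solution solves an ordinary differential equation. -/
lemma floquet_ode (hz : IsLinearizedSolution a b T x z) (hT : T = n * h) (hh : 0 < h) (hν : ν ≠ 0)
    (hfl : ∀ θ ∈ Icc (-T) 0, z (h + θ) = ν • z θ) :
    (∀ t ∈ Icc 0 h, HasDerivWithinAt (fun t => (z t).1) (z t).2 (Icc 0 h) t) ∧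
    ∀ t ∈ Icc 0 h, HasDerivWithinAt (fun t => (z t).2)
      (-(a + b * (ν ^ n)⁻¹ + 3 * (x t : ℂ) ^ 2) * (z t).1) (Icc 0 h) t := by
  refine ⟨fun t ht => ((hz.hasDerivWithinAt t ht.1).mono Icc_subset_Ici_self).fst_comp,
    fun t ht => ?_⟩
  refine (((hz.hasDerivWithinAt t ht.1).mono Icc_subset_Ici_self).snd_comp).congr_deriv ?_
  have h1 := congrArg Prod.fst (floquet_delay hT hh hfl ht)
  rw [Prod.smul_fst, smul_eq_mul] at h1
  have h2 : (z (t - T)).1 = (ν ^ n)⁻¹ * (z t).1 := by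
    rw [h1, inv_mul_cancel_left₀ (pow_ne_zero n hν)]
  simp only [h2]
  ring

/-- A Floquet solution vanishing at `0` vanishes. -/
lemma floquet_eq_zero (hz : IsLinearizedSolution a b T x z) (hx : Continuous x) (hT : T = n * h)
    (hh : 0 < h) (hν : ν ≠ 0) (hfl : ∀ θ ∈ Icc (-T) 0, z (h + θ) = ν • z θ) (h0 : z 0 = 0) :
    ∀ θ ∈ Icc (-T) 0, z θ = 0 := by
  obtain ⟨h1, h2⟩ := hz.floquet_ode hT hh hν hfl
  have h3 := planar_linear_eq_zero (L := h) (p := fun _ => 1)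
    (q := fun t => -(a + b * (ν ^ n)⁻¹ + 3 * (x t : ℂ) ^ 2)) continuousOn_const
    (Continuous.continuousOn (by fun_prop)) (fun t ht => by simpa using h1 t ht) h2
    (by simp [h0]) (by simp [h0])
  intro θ hθ
  obtain ⟨t, ht, j, hj, rfl⟩ := exists_decomposition hT hh hθ
  have h4 := floquet_delay hT hh hfl ht
  rw [show z t = 0 from Prod.ext (h3 t ht).1 (h3 t ht).2] at h4
  have h5 : z (t - T) = 0 := (smul_eq_zero.1 h4.symm).resolve_left (pow_ne_zero n hν)
  rw [floquet_iterate hT hh hfl ht j hj, h5, smul_zero]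

end IsLinearizedSolution

/-- The restriction of `z` to `[τ - T, τ]`, shifted to `[-T, 0]`. -/
def historyAt (T : ℝ) (z : ℝ → ℂ × ℂ) (hz : ContinuousOn z (Ici (-T))) (τ : ℝ) (hτ : 0 ≤ τ) :
    PhaseSpace T :=
  ⟨fun θ => z (τ + θ), by
    refine hz.comp_continuous (by fun_prop) fun θ => ?_
    have := θ.2.1
    exact mem_Ici.2 (by linarith)⟩

section Multipliers

variable {a b T h : ℝ} {x : ℝ → ℝ} {n : ℕ} {ν : ℂ}

lemma isMultiplier_of_solution {z : ℝ → ℂ × ℂ} {τ : ℝ} (hz : IsLinearizedSolution a b T x z)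
    (hν : ν ≠ 0) (hfl : ∀ θ ∈ Icc (-T) 0, z (τ + θ) = ν • z θ)
    (h0 : ∃ θ ∈ Icc (-T) 0, z θ ≠ 0) : IsMultiplier a b T x τ ν := by
  refine ⟨hν, historyAt T z hz.continuousOn 0 le_rfl, fun h => ?_, z, hz, fun θ => ?_, fun θ => ?_⟩
  · obtain ⟨θ, hθ, h1⟩ := h0
    have := congrArg (fun φ : PhaseSpace T => φ ⟨θ, hθ⟩) h
    simp [historyAt] at this
    exact h1 this
  · simp [historyAt]
  · simp [historyAt, hfl θ θ.2]

lemma IsMultiplier.exists_solution {τ : ℝ} (hm : IsMultiplier a b T x τ ν) :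
    ∃ z : ℝ → ℂ × ℂ, IsLinearizedSolution a b T x z ∧
      (∀ θ ∈ Icc (-T) 0, z (τ + θ) = ν • z θ) ∧ ∃ θ ∈ Icc (-T) 0, z θ ≠ 0 := by
  obtain ⟨-, φ, hφ, z, hz, h1, h2⟩ := hm
  refine ⟨z, hz, fun θ hθ => ?_, ?_⟩
  · rw [h2 ⟨θ, hθ⟩, h1 ⟨θ, hθ⟩]; rfl
  · by_contra! hc
    refine hφ (ContinuousMap.ext fun θ => ?_)
    rw [← h1 θ, hc θ θ.2]; rfl

lemma IsMultiplier.conj {τ : ℝ} (hm : IsMultiplier a b T x τ ν) :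
    IsMultiplier a b T x τ (star ν) := by
  obtain ⟨z, hz, h1, θ, hθ, h2⟩ := hm.exists_solution
  refine isMultiplier_of_solution hz.conj (star_ne_zero.2 hm.1) (fun θ hθ => ?_)
    ⟨θ, hθ, star_ne_zero.2 h2⟩
  simp only [h1 θ hθ, star_smul]

/-- The multipliers over twice the time are squares of multipliers. -/
lemma IsMultiplier.exists_sq_eq (hm : IsMultiplier a b T x (2 * h) ν) (hh : 0 ≤ h)
    (hx : ∀ t, x (t + h) ^ 2 = x t ^ 2) : ∃ ρ, ρ ^ 2 = ν ∧ IsMultiplier a b T x h ρ := by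
  obtain ⟨ρ, hρ⟩ := IsAlgClosed.exists_pow_nat_eq ν two_pos
  have hρ0 : ρ ≠ 0 := by rintro rfl; exact hm.1 (by rw [← hρ]; simp)
  obtain ⟨z, hz, h1, h2⟩ := hm.exists_solution
  -- Factor Π² - ρ² = (Π - ρ)(Π + ρ) for the half-period map Π: either (Π + ρ)z is an eigenvector
  -- for ρ, or z itself is one for -ρ.
  by_cases hc : ∃ θ ∈ Icc (-T) 0, z (θ + h) + ρ • z θ ≠ 0
  · refine ⟨ρ, hρ, isMultiplier_of_solution ((hz.shift hh hx).add (hz.const_smul ρ)) hρ0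
      (fun θ hθ => ?_) hc⟩
    have h3 : h + θ + h = 2 * h + θ := by ring
    rw [h3, h1 θ hθ, add_comm h θ, ← hρ, smul_add, smul_smul, pow_two, add_comm]
  · push Not at hc
    refine ⟨-ρ, by rw [neg_sq, hρ], isMultiplier_of_solution hz (neg_ne_zero.2 hρ0)
      (fun θ hθ => ?_) h2⟩
    rw [add_comm, neg_smul]
    exact eq_neg_of_add_eq_zero_left (hc θ hθ)

/-- Floquet solutions of an ordinary differential equation solve the delay equation. -/
lemma isLinearizedSolution_of_floquet {y y' : ℝ → ℂ} (hT : T = n * h) (hν : ν ≠ 0)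
    (hy : ∀ t, HasDerivAt y (y' t) t)
    (hy' : ∀ t, HasDerivAt y' (-(a + b * (ν ^ n)⁻¹ + 3 * (x t : ℂ) ^ 2) * y t) t)
    (hfl : ∀ t, y (t + h) = ν * y t) : IsLinearizedSolution a b T x (fun t => (y t, y' t)) := by
  have hit : ∀ (j : ℕ) t, y (t + j * h) = ν ^ j * y t := by
    intro j
    induction j with
    | zero => simp
    | succ j ih =>
      intro t
      rw [show t + ((j + 1 : ℕ) : ℝ) * h = t + j * h + h by push_cast; ring, hfl, ih]
      ring
  refine ⟨Continuous.continuousOn ?_, fun t _ => ?_⟩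
  · exact (continuous_iff_continuousAt.2 fun t => (hy t).continuousAt).prodMk
      (continuous_iff_continuousAt.2 fun t => (hy' t).continuousAt)
  · refine (((hy t).prodMk (hy' t)).hasDerivWithinAt).congr_deriv ?_
    have h1 : y t = ν ^ n * y (t - T) := by
      rw [← hit]; congr 1; linarith
    have h2 : y (t - T) = (ν ^ n)⁻¹ * y t := by
      rw [h1, inv_mul_cancel_left₀ (pow_ne_zero n hν)]
    simp only [h2]
    ext
    · rfl
    · simp only; ring

end Multipliers

/-! ### Algebraic simplicity of the trivial Floquet multiplier. -/

section Simplicity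

variable {a b T h α : ℝ} {x : ℝ → ℝ} {n : ℕ}

/-- The derivative of the orbit, as a complex phase curve. -/
noncomputable def tangentCurve (α : ℝ) (x : ℝ → ℝ) (t : ℝ) : ℂ × ℂ :=
  (((deriv x t : ℝ) : ℂ), ((-α * x t - x t ^ 3 : ℝ) : ℂ))

lemma IsDuffingOrbit.hasDerivAt_tangent {A p : ℝ} (hx : IsDuffingOrbit α A p x) (t : ℝ) :
    HasDerivAt (fun t => (tangentCurve α x t).1) (tangentCurve α x t).2 t ∧
    HasDerivAt (fun t => (tangentCurve α x t).2)
      (-(α + 3 * (x t : ℂ) ^ 2) * (tangentCurve α x t).1) t := by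
  refine ⟨(hx.hasDerivAt_deriv t).ofReal_comp, ?_⟩
  have h := (((hx.hasDerivAt t).const_mul (-α)).sub ((hx.hasDerivAt t).pow 3)).ofReal_comp
  refine h.congr_deriv ?_
  simp only [tangentCurve]
  push_cast
  ring

lemma tangentCurve_antiperiodic (hx : ∀ t, x (t + h) = -x t)
    (hx' : ∀ t, deriv x (t + h) = -deriv x t) (t : ℝ) :
    tangentCurve α x (t + h) = -tangentCurve α x t := by
  ext
  · simp [tangentCurve, hx']
  · simp [tangentCurve, hx]; ring

/-- The velocity is a Floquet solution with half-period factor -1, and b (-1)^(-n) = (-1)^n b is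
exactly the coefficient that turns a into α. -/
lemma IsDuffingOrbit.isLinearizedSolution_tangent {A p : ℝ} (hx : IsDuffingOrbit α A p x)
    (hα : α = a + (-1) ^ n * b) (hT : T = n * h)
    (hxa' : ∀ t, deriv x (t + h) = -deriv x t) :
    IsLinearizedSolution a b T x (tangentCurve α x) := by
  refine isLinearizedSolution_of_floquet (ν := -1) hT (by simp)
    (fun t => (hx.hasDerivAt_tangent t).1) (fun t => ?_) (fun t => ?_)
  · refine (hx.hasDerivAt_tangent t).2.congr_deriv ?_
    have e : ((-1 : ℂ) ^ n)⁻¹ = (-1) ^ n := by rw [← inv_pow, inv_neg, inv_one]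
    have e' : (α : ℂ) = a + (-1) ^ n * b := by rw [hα]; push_cast; ring
    rw [e, e', mul_comm (b : ℂ)]
    rfl
  · rw [hxa']
    push_cast; ring

/-- If the trivial multiplier of the ordinary differential equation is geometrically simple and `1`
is not a half-period multiplier, then the Floquet multiplier `1` is algebraically simple. -/
theorem IsDuffingOrbit.isAlgebraicallySimple {A p : ℝ} (hx : IsDuffingOrbit α A p x) (hb : b ≠ 0)
    (hn : n ≠ 0) (hα : α = a + (-1) ^ n * b) (hT : T = n * h) (hh : 0 < h)
    (hxa : ∀ t, x (t + h) = -x t) (hxa' : ∀ t, deriv x (t + h) = -deriv x t)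
    (hX0 : (tangentCurve α x 0).2 ≠ 0) (h1 : ¬ IsMultiplier a b T x h 1)
    (hgeo : ∀ y y' : ℝ → ℂ, (∀ t ∈ Icc 0 h, HasDerivWithinAt y (y' t) (Icc 0 h) t) →
      (∀ t ∈ Icc 0 h, HasDerivWithinAt y' (-(α + 3 * (x t : ℂ) ^ 2) * y t) (Icc 0 h) t) →
      y' h = -y' 0 → y 0 = 0) : IsAlgebraicallySimple a b T x (2 * h) 1 := by
  set X := tangentCurve α x with hXdef
  have hX : IsLinearizedSolution a b T x X := hx.isLinearizedSolution_tangent hα hT hxa'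
  have hXa : ∀ t, X (t + h) = -X t := tangentCurve_antiperiodic hxa hxa'
  have hXfl : ∀ θ, X (h + θ) = (-1 : ℂ) • X θ := fun θ => by
    rw [add_comm, hXa, neg_one_smul]
  have hx2 : ∀ t, x (t + h) ^ 2 = x t ^ 2 := fun t => by rw [hxa, neg_sq]
  have hT0 : 0 < T := by rw [hT]; positivity
  have h00 : (0 : ℝ) ∈ Icc (-T) 0 := ⟨by linarith, le_rfl⟩
  set φ := historyAt T X hX.continuousOn 0 le_rfl with hφ
  have hφv : ∀ θ : Icc (-T) (0 : ℝ), φ θ = X θ := fun θ => by simp [hφ, historyAt]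
  -- A one-step statement is enough: if a history maps to itself plus a multiple of φ, then it is a
  -- multiple of φ. Induction then collapses every generalized kernel.
  have hstep : ∀ (ψ : PhaseSpace T) (d : ℂ),
      EvolvesTo a b T x (2 * h) ψ ((1 : ℂ) • ψ + d • φ) → ∃ c : ℂ, ψ = c • φ := by
    rintro ψ d ⟨z, hz, hzψ, hzψ'⟩
    have hz2 : ∀ θ ∈ Icc (-T) 0, z (2 * h + θ) = z θ + d • X θ := by
      intro θ hθ
      have e1 := hzψ ⟨θ, hθ⟩
      have e2 := hzψ' ⟨θ, hθ⟩
      simp only at e1 e2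
      rw [e2, e1, one_smul, ContinuousMap.add_apply, ContinuousMap.smul_apply, hφv]
    -- the component of `z` along the eigenvalue `1` vanishes
    set c : ℂ := -(d / 2) with hc
    have hzh : ∀ θ ∈ Icc (-T) 0, z (h + θ) = -z θ + c • X θ := by
      have hv := ((hz.shift hh.le hx2).add hz).add (hX.const_smul (d / 2))
      have hv0 : ∀ θ ∈ Icc (-T) 0, z (θ + h) + z θ + (d / 2) • X θ = 0 := by
        by_contra! hcon
        refine h1 (isMultiplier_of_solution hv one_ne_zero (fun θ hθ => ?_) hcon)
        have e3 : h + θ + h = 2 * h + θ := by ring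
        rw [e3, hz2 θ hθ, hXfl, add_comm h θ, one_smul]
        ext <;> simp <;> ring
      intro θ hθ
      have e := hv0 θ hθ
      rw [add_comm h θ, hc]
      have e4 : z (θ + h) = -(z θ + (d / 2) • X θ) :=
        eq_neg_of_add_eq_zero_left (by rw [← e]; abel)
      rw [e4, neg_smul]
      abel
    -- Iterating a Jordan block for the eigenvalue -1 gives a secular term that grows linearly in
    -- the number of half periods.
    have hit : ∀ t ∈ Icc 0 h, ∀ j : ℕ, j ≤ n →
        z (t - T + j * h) = (-1 : ℂ) ^ j • (z (t - T) - (j * c) • X (t - T)) := by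
      intro t ht j
      induction j with
      | zero => intro _; simp
      | succ j ih =>
        intro hj
        have hj' : (j : ℝ) + 1 ≤ n := by exact_mod_cast hj
        have hXj := IsLinearizedSolution.floquet_iterate hT hh (fun θ _ => hXfl θ) ht j (by omega)
        have e := hzh (t - T + j * h) ⟨by
          have : 0 ≤ (j : ℝ) * h := by positivity
          linarith [ht.1], by rw [hT]; nlinarith [ht.2]⟩
        rw [ih (by omega), hXj] at e
        rw [show t - T + ((j + 1 : ℕ) : ℝ) * h = h + (t - T + j * h) by push_cast; ring, e]
        ext <;> simp <;> ring
    have hdelay : ∀ t ∈ Icc 0 h, (z (t - T)).1 =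
        (-1 : ℂ) ^ n * ((z t).1 + n * c * (X t).1) := by
      intro t ht
      have e1 := congrArg Prod.fst (hit t ht n le_rfl)
      have e2 := congrArg Prod.fst
        (IsLinearizedSolution.floquet_delay hT hh (fun θ _ => hXfl θ) ht)
      rw [show t - T + n * h = t by linarith] at e1
      simp only [Prod.smul_fst, Prod.fst_sub, smul_eq_mul] at e1 e2
      have e3 : ((-1 : ℂ) ^ n) * (-1) ^ n = 1 := by rw [← mul_pow]; simp
      rw [e1, e2]
      linear_combination (-(z (t - T)).1) * e3
    -- After n half periods the secular term acts as a forcing by the velocity in the ordinary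
    -- differential equation, with this strength.
    set κ : ℂ := b * n * c * (-1) ^ n with hκ
    have hode1 : ∀ t ∈ Icc 0 h, HasDerivWithinAt (fun t => (z t).1) (z t).2 (Icc 0 h) t :=
      fun t ht => ((hz.hasDerivWithinAt t ht.1).mono Icc_subset_Ici_self).fst_comp
    have hode2 : ∀ t ∈ Icc 0 h, HasDerivWithinAt (fun t => (z t).2)
        (-(α + 3 * (x t : ℂ) ^ 2) * (z t).1 - κ * (X t).1) (Icc 0 h) t := by
      intro t ht
      refine (((hz.hasDerivWithinAt t ht.1).mono Icc_subset_Ici_self).snd_comp).congr_deriv ?_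
      simp only [hdelay t ht, hκ, hα]
      push_cast
      ring
    have hXd := hx.hasDerivAt_tangent
    have hXc : Continuous fun t => (X t).1 :=
      continuous_iff_continuousAt.2 fun t => (hXd t).1.continuousAt
    have hXc2 : Continuous fun t => (X t).2 :=
      continuous_iff_continuousAt.2 fun t => (hXd t).2.continuousAt
    have hzh0 := hzh 0 h00
    have hXh0 := hXfl 0
    rw [add_zero] at hzh0 hXh0
    -- Green's identity with the tangent solution
    have hκ0 : κ = 0 := by
      have hW := intervalIntegral.integral_eq_sub_of_hasDerivAt_of_le hh.le
        (f := fun t => (z t).2 * (X t).1 - (z t).1 * (X t).2)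
        (f' := fun t => -κ * ((deriv x t ^ 2 : ℝ) : ℂ)) ?_ ?_ ?_
      · rw [intervalIntegral.integral_const_mul, intervalIntegral.integral_ofReal] at hW
        have hpos : 0 < ∫ t in (0 : ℝ)..h, deriv x t ^ 2 := by
          -- The orbit moves from A to -A over the half period, so its velocity is nonzero
          -- somewhere.
          obtain ⟨t, ht, hd⟩ := exists_hasDerivAt_eq_slope x (deriv x) hh hx.continuous.continuousOn
            (fun t _ => hx.hasDerivAt t)
          have hxh : x h = -A := by
            have := hxa 0
            rwa [zero_add, hx.initial] at this
          have hd0 : deriv x t ≠ 0 := by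
            rw [hd, hxh, hx.initial]
            have := hx.amplitude_pos
            exact div_ne_zero (by linarith) (by linarith)
          refine intervalIntegral.integral_pos hh ?_ (fun s _ => sq_nonneg _)
            ⟨t, Ioo_subset_Icc_self ht, by positivity⟩
          exact ((continuous_iff_continuousAt.2
            fun s => (hx.hasDerivAt_deriv s).continuousAt).pow 2).continuousOn
        -- The boundary terms at 0 and h cancel: both curves change sign, and the extra term c X
        -- contributes only the Wronskian of X with itself.
        rw [hzh0, hXh0] at hW
        simp at hW
        have e : κ * ((∫ t in (0 : ℝ)..h, deriv x t ^ 2 : ℝ) : ℂ) = 0 := by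
          linear_combination -hW
        exact (mul_eq_zero.1 e).resolve_right (Complex.ofReal_ne_zero.2 hpos.ne')
      · exact ContinuousOn.sub
          (ContinuousOn.mul (fun t ht => (hode2 t ht).continuousWithinAt) hXc.continuousOn)
          (ContinuousOn.mul (fun t ht => (hode1 t ht).continuousWithinAt) hXc2.continuousOn)
      · intro t ht
        have hm := Icc_mem_nhds ht.1 ht.2
        have ht' := Ioo_subset_Icc_self ht
        refine ((((hode2 t ht').hasDerivAt hm).mul (hXd t).1).sub
          (((hode1 t ht').hasDerivAt hm).mul (hXd t).2)).congr_deriv ?_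
        have : (X t).1 = ((deriv x t : ℝ) : ℂ) := rfl
        rw [← hXdef, this]
        push_cast
        ring
      · refine Continuous.intervalIntegrable ?_ _ _
        have : Continuous (deriv x) := continuous_iff_continuousAt.2
          fun s => (hx.hasDerivAt_deriv s).continuousAt
        fun_prop
    have hc0 : c = 0 := by
      have h2 : (b : ℂ) ≠ 0 := Complex.ofReal_ne_zero.2 hb
      have h3 : (n : ℂ) ≠ 0 := Nat.cast_ne_zero.2 hn
      have h4 : (-1 : ℂ) ^ n ≠ 0 := pow_ne_zero _ (by simp)
      rw [hκ] at hκ0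
      simpa [h2, h3, h4] using hκ0
    rw [hc0, zero_smul, add_zero] at hzh0
    have hy0 : (z 0).1 = 0 := by
      refine hgeo _ _ hode1 (fun t ht => ?_) (congrArg Prod.snd hzh0)
      refine (hode2 t ht).congr_deriv ?_
      rw [hκ0]; ring
    set m : ℂ := (z 0).2 / (X 0).2 with hm
    have hX10 : (X 0).1 = 0 := by
      change ((deriv x 0 : ℝ) : ℂ) = 0
      rw [hx.initial_deriv, Complex.ofReal_zero]
    have hzero := (hz.add (hX.const_smul (-m))).floquet_eq_zero hx.continuous hT hh (ν := -1)
      (by simp) (fun θ hθ => by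
        rw [hzh θ hθ, hXfl, hc0]
        ext <;> simp) (by
        refine Prod.ext ?_ ?_
        · simp [hy0, hX10]
        · simp only [Prod.snd_add, Prod.smul_snd, smul_eq_mul, hm]
          field_simp
          simp)
    refine ⟨m, ContinuousMap.ext fun θ => ?_⟩
    have e := hzero θ θ.2
    rw [hzψ θ, neg_smul] at e
    rw [ContinuousMap.smul_apply, hφv]
    exact add_neg_eq_zero.1 e
  have hφ0 : φ ≠ 0 := by
    intro hcon
    have := congrArg (fun ψ : PhaseSpace T => (ψ ⟨0, h00⟩).2) hcon
    simp only [hφv] at this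
    exact hX0 this
  refine ⟨φ, hφ0, fun ψ => ⟨?_, ?_⟩⟩
  · rintro ⟨k, hk⟩
    have : ∀ (k : ℕ) (ψ : PhaseSpace T), InGeneralizedKernel a b T x (2 * h) 1 k ψ →
        ∃ c : ℂ, ψ = c • φ := by
      intro k
      induction k with
      | zero => intro ψ hψ; exact ⟨0, (show ψ = 0 from hψ).trans (ContinuousMap.ext fun θ => by simp)⟩
      | succ k ih =>
        rintro ψ ⟨χ, hχ, hχ'⟩
        obtain ⟨d, rfl⟩ := ih χ hχ'
        exact hstep ψ d hχ
    exact this k ψ hk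
  · rintro ⟨c, rfl⟩
    refine ⟨1, 0, ⟨fun t => c • X t, hX.const_smul c, fun θ => ?_, fun θ => ?_⟩, rfl⟩
    · rw [ContinuousMap.smul_apply, hφv]
    · change c • X (2 * h + θ) = _
      rw [one_smul, add_zero, ContinuousMap.smul_apply, hφv,
        show 2 * h + (θ : ℝ) = θ + h + h by ring, hXa, hXa, neg_neg]

end Simplicity

/-! ### Multipliers and the characteristic equation. -/

/-- For every `η` the Hill system has a fundamental system on `[0, π]` whose monodromy has negative
trace `2 + η G(k, η)`, and is not the negative of the identity for `η = 0`. -/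
def HasDiscriminant (G : ℂ × ℂ → ℂ) (k : ℝ) : Prop :=
  ∀ η : ℂ, ∃ c c' s s' : ℝ → ℂ,
      HillSolution k η (Icc 0 Real.pi) c c' ∧ HillSolution k η (Icc 0 Real.pi) s s' ∧
      c 0 = 1 ∧ c' 0 = 0 ∧ s 0 = 0 ∧ s' 0 = 1 ∧
      -(c Real.pi + s' Real.pi) = 2 + η * G (k, η) ∧ (η = 0 → c' Real.pi ≠ 0)

namespace HillSolution

variable {k : ℝ} {η : ℂ} {c c' s s' w v : ℝ → ℂ}

lemma eq_combination (hk : -(1 / 2) < k) (hc : HillSolution k η (Icc 0 Real.pi) c c')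
    (hs : HillSolution k η (Icc 0 Real.pi) s s') (hc0 : c 0 = 1) (hc0' : c' 0 = 0) (hs0 : s 0 = 0)
    (hs0' : s' 0 = 1) (h : HillSolution k η (Icc 0 Real.pi) w v) :
    w Real.pi = w 0 * c Real.pi + v 0 * s Real.pi ∧
      v Real.pi = w 0 * c' Real.pi + v 0 * s' Real.pi :=
  h.eq_of_initial hk ((hc.const_mul (w 0)).add (hs.const_mul (v 0))) (by simp [hc0, hs0])
    (by simp [hc0', hs0']) Real.pi (right_mem_Icc.2 Real.pi_pos.le)

lemma det_monodromy (hk : -(1 / 2) < k) (hc : HillSolution k η (Icc 0 Real.pi) c c')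
    (hs : HillSolution k η (Icc 0 Real.pi) s s') (hc0 : c 0 = 1) (hc0' : c' 0 = 0) (hs0 : s 0 = 0)
    (hs0' : s' 0 = 1) : c Real.pi * s' Real.pi - c' Real.pi * s Real.pi = 1 := by
  have h := hc.wronskian hk hs
  rw [hc0, hc0', hs0, hs0'] at h
  linear_combination h

end HillSolution

section Characteristic

variable {a b T α A p k r : ℝ} {x : ℝ → ℝ} {n : ℕ} {ν : ℂ} {G : ℂ × ℂ → ℂ}

/-- The parameter `η` of the Hill system belonging to a multiplier `-ν`. -/
lemma hill_parameter (hα : α = a + (-1) ^ n * b) (ν : ℂ) :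
    (a : ℂ) + b * (ν ^ n)⁻¹ = α + ((-1) ^ n * b : ℝ) * (((-ν) ^ n)⁻¹ - 1) := by
  rw [hα, neg_pow ν, mul_inv, ← inv_pow (-1 : ℂ), inv_neg, inv_one]
  have h : ((-1 : ℂ) ^ n) * (-1) ^ n = 1 := by rw [← mul_pow]; simp
  push_cast
  linear_combination (-(b : ℂ) * (ν ^ n)⁻¹) * h

/-- Multipliers satisfy the characteristic equation. -/
lemma IsDuffingOrbit.characteristic (hx : IsDuffingOrbit α A p x) (hr : r * A = 1)
    (hkα : k = r ^ 2 * α) (hk : -(1 / 2) < k) (hα : α = a + (-1) ^ n * b)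
    (hT : T = n * (r * halfPeriod k)) (hh : 0 < r * halfPeriod k) (hG : HasDiscriminant G k)
    (hm : IsMultiplier a b T x (r * halfPeriod k) ν) :
    -ν + (-ν)⁻¹ = 2 + (r ^ 2 * ((-1) ^ n * b : ℝ) * (((-ν) ^ n)⁻¹ - 1)) *
      G (k, r ^ 2 * ((-1) ^ n * b : ℝ) * (((-ν) ^ n)⁻¹ - 1)) := by
  obtain ⟨z, hz, hfl, θ, hθ, hzθ⟩ := hm.exists_solution
  obtain ⟨ho1, ho2⟩ := hz.floquet_ode hT hh hm.1 hfl
  have hT0 : 0 ≤ T := by rw [hT]; positivity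
  have h00 : (0 : ℝ) ∈ Icc (-T) 0 := ⟨by linarith, le_rfl⟩
  have hH := hx.hillSolution hr hkα hk (μ := ((-1) ^ n * b : ℝ) * (((-ν) ^ n)⁻¹ - 1)) ho1
    (fun t ht => by rw [← hill_parameter hα]; exact ho2 t ht)
  rw [← mul_assoc] at hH
  obtain ⟨c, c', s, s', hc, hs, hc0, hc0', hs0, hs0', htr, -⟩ :=
    hG ((r : ℂ) ^ 2 * ((-1) ^ n * b : ℝ) * (((-ν) ^ n)⁻¹ - 1))
  obtain ⟨e1, e2⟩ := HillSolution.eq_combination hk hc hs hc0 hc0' hs0 hs0' hH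
  have hdet := HillSolution.det_monodromy hk hc hs hc0 hc0' hs0 hs0'
  have hz0 := hfl 0 h00
  rw [add_zero] at hz0
  simp only [angleTime_pi, angleTime_zero, mul_zero, hz0, Prod.smul_fst, Prod.smul_snd,
    smul_eq_mul] at e1 e2
  have hν := hm.1
  have hchar : ν ^ 2 - (c Real.pi + s' Real.pi) * ν + 1 = 0 := by
    -- If ν were not an eigenvalue of the monodromy, the initial vector would vanish, and with it
    -- the entire Floquet solution.
    by_contra hne
    have hr0 : (r : ℂ) ≠ 0 := by
      rintro h0
      rw [Complex.ofReal_eq_zero] at h0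
      rw [h0, zero_mul] at hh
      exact lt_irrefl _ hh
    have f1 : (ν ^ 2 - (c Real.pi + s' Real.pi) * ν + 1) * (z 0).1 = 0 := by
      linear_combination (ν - s' Real.pi) * e1 + s Real.pi * e2 - (z 0).1 * hdet
    have f2 : (ν ^ 2 - (c Real.pi + s' Real.pi) * ν + 1) * (r * (z 0).2) = 0 := by
      linear_combination (ν - c Real.pi) * e2 + c' Real.pi * e1 - (r * (z 0).2) * hdet
    have g1 := (mul_eq_zero.1 f1).resolve_left hne
    have g2 := (mul_eq_zero.1 ((mul_eq_zero.1 f2).resolve_left hne)).resolve_left hr0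
    exact hzθ (hz.floquet_eq_zero hx.continuous hT hh hν hfl (Prod.ext g1 g2) θ hθ)
  rw [← htr, inv_neg]
  field_simp
  linear_combination -hchar

/-- Solutions of the characteristic equation yield Floquet solutions. -/
lemma IsDuffingOrbit.exists_floquet_of_characteristic (hx : IsDuffingOrbit α A p x)
    (hr : r * A = 1) (hkα : k = r ^ 2 * α) (hk : -(1 / 2) < k) (hα : α = a + (-1) ^ n * b)
    (hT : T = n * (r * halfPeriod k)) (hG : HasDiscriminant G k) (hν : ν ≠ 0)
    (hchar : -ν + (-ν)⁻¹ = 2 + (r ^ 2 * ((-1) ^ n * b : ℝ) * (((-ν) ^ n)⁻¹ - 1)) *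
      G (k, r ^ 2 * ((-1) ^ n * b : ℝ) * (((-ν) ^ n)⁻¹ - 1))) :
    ∃ z, IsLinearizedSolution a b T x z ∧ (∀ t, z (t + r * halfPeriod k) = ν • z t) ∧ z 0 ≠ 0 := by
  obtain ⟨c, c', s, s', hc, hs, hc0, hc0', hs0, hs0', htr, -⟩ :=
    hG ((r : ℂ) ^ 2 * ((-1) ^ n * b : ℝ) * (((-ν) ^ n)⁻¹ - 1))
  have hdet := HillSolution.det_monodromy hk hc hs hc0 hc0' hs0 hs0'
  have hquad : ν ^ 2 - (c Real.pi + s' Real.pi) * ν + 1 = 0 := by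
    rw [← htr, inv_neg] at hchar
    field_simp at hchar
    linear_combination -hchar
  -- An eigenvector of the monodromy supplies the initial data of the Floquet solution.
  obtain ⟨u, hu, hMu⟩ := (Matrix.exists_mulVec_eq_zero_iff
    (M := !![c Real.pi - ν, s Real.pi; c' Real.pi, s' Real.pi - ν])).2 (by
      rw [Matrix.det_fin_two_of]
      linear_combination hquad + hdet)
  have h1 := congrFun hMu 0
  have h2 := congrFun hMu 1
  simp [Matrix.mulVec, dotProduct, Fin.sum_univ_two] at h1 h2
  have hH := (hc.const_mul (u 0)).add (hs.const_mul (u 1))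
  rw [mul_assoc] at hH
  obtain ⟨y, y', hy, hy', hfl, hfl', hy0, hy0'⟩ := hx.exists_floquet hr hkα hk hν hH
    (by simp only [hc0, hs0]; linear_combination h1)
    (by simp only [hc0', hs0']; linear_combination h2)
  refine ⟨fun t => (y t, y' t), isLinearizedSolution_of_floquet hT hν hy
    (fun t => by rw [hill_parameter hα]; exact hy' t) hfl, fun t => ?_, fun h0 => hu ?_⟩
  · simp only [hfl, hfl']; rfl
  · rw [Prod.mk_eq_zero] at h0
    rw [h0.1] at hy0
    rw [h0.2] at hy0'
    simp only [hc0, hs0, hc0', hs0'] at hy0 hy0'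
    ext i
    fin_cases i
    · simpa using hy0.symm
    · simpa using hy0'.symm

/-- The trivial multiplier is geometrically simple. -/
lemma IsDuffingOrbit.antiperiodic_initial_eq_zero (hx : IsDuffingOrbit α A p x)
    (hr : r * A = 1) (hkα : k = r ^ 2 * α) (hk : -(1 / 2) < k) (hG : HasDiscriminant G k)
    (hX0 : (tangentCurve α x 0).2 ≠ 0) {y y' : ℝ → ℂ}
    (hy : ∀ t ∈ Icc 0 (r * halfPeriod k), HasDerivWithinAt y (y' t) (Icc 0 (r * halfPeriod k)) t)
    (hy' : ∀ t ∈ Icc 0 (r * halfPeriod k), HasDerivWithinAt y'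
      (-(α + 3 * (x t : ℂ) ^ 2) * y t) (Icc 0 (r * halfPeriod k)) t)
    (hya' : y' (r * halfPeriod k) = -y' 0) : y 0 = 0 := by
  have hr0 : (r : ℂ) ≠ 0 := by
    rintro h0
    rw [Complex.ofReal_eq_zero] at h0
    rw [h0, zero_mul] at hr
    exact zero_ne_one hr
  obtain ⟨c, c', s, s', hc, hs, hc0, hc0', hs0, hs0', htr, hne⟩ := hG 0
  have hH := hx.hillSolution hr hkα hk (μ := 0) hy (fun t ht => by simpa using hy' t ht)
  have hXH := hx.hillSolution hr hkα hk (μ := 0)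
    (fun t _ => (hx.hasDerivAt_tangent t).1.hasDerivWithinAt)
    (fun t _ => by simpa using (hx.hasDerivAt_tangent t).2.hasDerivWithinAt)
  rw [mul_zero] at hH hXH
  have e2 := (HillSolution.eq_combination hk hc hs hc0 hc0' hs0 hs0' hH).2
  obtain ⟨f1, f2⟩ := HillSolution.eq_combination hk hc hs hc0 hc0' hs0 hs0' hXH
  have hXa := tangentCurve_antiperiodic (fun t => (hx.antiperiodic hr hkα hk t).1)
    (fun t => (hx.antiperiodic hr hkα hk t).2) (α := α) 0
  rw [zero_add] at hXa
  have hX1 : (tangentCurve α x 0).1 = 0 := by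
    change ((deriv x 0 : ℝ) : ℂ) = 0
    rw [hx.initial_deriv, Complex.ofReal_zero]
  simp only [angleTime_pi, angleTime_zero, mul_zero, hya', hXa, Prod.fst_neg, Prod.snd_neg,
    hX1] at e2 f1 f2
  -- The velocity has vanishing first component at 0, so it is a multiple of the solution s and
  -- determines s(π) = 0 and s'(π) = -1. The second row of the monodromy then leaves y(0) c'(π) = 0.
  have g1 : s Real.pi = 0 := by
    refine (mul_eq_zero.1 (?_ : (r * (tangentCurve α x 0).2) * s Real.pi = 0)).resolve_left
      (mul_ne_zero hr0 hX0)
    linear_combination -f1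
  have g2 : s' Real.pi = -1 := by
    refine mul_left_cancel₀ (mul_ne_zero hr0 hX0) ?_
    linear_combination -f2
  rw [g2] at e2
  exact (mul_eq_zero.1 (by linear_combination -e2)).resolve_right (hne rfl)

end Characteristic

/-! ### Analyticity and expansion of σ. -/

section Sigma

variable {M : ℂ × ℂ → ℂ}

/-- The real part of `exp (T² M(r, T))`. -/
noncomputable def sigmaOfExponent (M : ℂ × ℂ → ℂ) (z : ℝ × ℝ) : ℝ :=
  (Complex.exp ((z.2 : ℂ) ^ 2 * M (z.1, z.2))).re

lemma analyticAt_sigmaOfExponent {z : ℝ × ℝ} (hM : AnalyticAt ℂ M (z.1, z.2)) :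
    AnalyticAt ℝ (sigmaOfExponent M) z := by
  have h1 : AnalyticAt ℝ (fun z : ℝ × ℝ => (z.1 : ℂ)) z :=
    (Complex.ofRealCLM.comp (ContinuousLinearMap.fst ℝ ℝ ℝ)).analyticAt z
  have h2 : AnalyticAt ℝ (fun z : ℝ × ℝ => (z.2 : ℂ)) z :=
    (Complex.ofRealCLM.comp (ContinuousLinearMap.snd ℝ ℝ ℝ)).analyticAt z
  have h3 : AnalyticAt ℝ (fun z : ℝ × ℝ => M (z.1, z.2)) z :=
    AnalyticAt.comp (g := M) (f := fun z : ℝ × ℝ => ((z.1 : ℂ), (z.2 : ℂ))) hM.restrictScalars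
      (h1.prod h2)
  have h4 : AnalyticAt ℝ (fun z : ℝ × ℝ => (z.2 : ℂ) ^ 2 * M (z.1, z.2)) z := (h2.pow 2).mul h3
  have h5 : AnalyticAt ℝ (fun z : ℝ × ℝ => Complex.exp ((z.2 : ℂ) ^ 2 * M (z.1, z.2))) z :=
    AnalyticAt.comp (g := Complex.exp) (f := fun z : ℝ × ℝ => (z.2 : ℂ) ^ 2 * M (z.1, z.2))
      (analyticAt_cexp.restrictScalars) h4
  exact (Complex.reCLM.analyticAt _).comp h5

/-- With w = T² M(0, T) one has exp(w) = 1 + w + O(w²), where w² = O(T⁴), and differentiability of M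
gives w = -βT²/3 + O(T³). -/
lemma sigmaOfExponent_isBigO {β : ℝ} (hM : ContDiffAt ℂ ω M (0, 0)) (hM0 : M (0, 0) = -β / 3) :
    (fun T : ℝ => sigmaOfExponent M (0, T) - (1 - β / 3 * T ^ 2)) =O[𝓝 0] fun T : ℝ => T ^ 3 := by
  have hcomp : DifferentiableAt ℝ (fun T : ℝ => M (0, (T : ℂ))) 0 := by
    have h1 : DifferentiableAt ℂ M (0, ((0 : ℝ) : ℂ)) := by
      simpa using hM.differentiableAt (by simp)
    have h2 : DifferentiableAt ℝ (fun T : ℝ => ((0 : ℂ), (T : ℂ))) 0 :=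
      (differentiableAt_const _).prodMk Complex.ofRealCLM.differentiableAt
    exact DifferentiableAt.comp (g := M) (f := fun T : ℝ => ((0 : ℂ), (T : ℂ))) 0
      (h1.restrictScalars ℝ) h2
  have hw0 : Tendsto (fun T : ℝ => (T : ℂ) ^ 2 * M (0, (T : ℂ))) (𝓝 0) (𝓝 0) := by
    have h : ContinuousAt (fun T : ℝ => (T : ℂ) ^ 2 * M (0, (T : ℂ))) 0 :=
      ContinuousAt.mul (by fun_prop) hcomp.continuousAt
    simpa [ContinuousAt] using h
  have h1 : (fun T : ℝ => M (0, (T : ℂ)) - -β / 3) =O[𝓝 0] fun T : ℝ => T := by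
    have := hcomp.isBigO_sub
    simpa [hM0] using this
  have h2 : (fun T : ℝ => (T : ℂ) ^ 2 * (M (0, (T : ℂ)) - -β / 3)) =O[𝓝 0] fun T : ℝ => T ^ 3 := by
    have h3 : (fun T : ℝ => (T : ℂ) ^ 2) =O[𝓝 0] fun T : ℝ => T ^ 2 :=
      IsBigO.of_bound 1 (Filter.Eventually.of_forall fun T => by simp)
    exact (h3.mul h1).congr_right fun T => by ring
  have h4 : (fun T : ℝ => (T : ℂ) ^ 2 * M (0, (T : ℂ))) =O[𝓝 0] fun T : ℝ => T ^ 2 := by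
    have h3 : (fun T : ℝ => (T : ℂ) ^ 2) =O[𝓝 0] fun T : ℝ => T ^ 2 :=
      IsBigO.of_bound 1 (Filter.Eventually.of_forall fun T => by simp)
    have h5 : (fun T : ℝ => M (0, (T : ℂ))) =O[𝓝 0] fun _ : ℝ => (1 : ℝ) :=
      hcomp.continuousAt.isBigO_one ℝ
    simpa using h3.mul h5
  have h6 : (fun T : ℝ => Complex.exp ((T : ℂ) ^ 2 * M (0, (T : ℂ))) - 1 -
      (T : ℂ) ^ 2 * M (0, (T : ℂ))) =O[𝓝 0] fun T : ℝ => T ^ 3 := by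
    have h7 : (fun w : ℂ => Complex.exp w - 1 - w) =O[𝓝 0] fun w => w ^ 2 := by
      refine IsBigO.of_bound 1 ?_
      filter_upwards [Metric.ball_mem_nhds (0 : ℂ) one_pos] with w hw
      rw [one_mul, norm_pow]
      exact Complex.norm_exp_sub_one_sub_id_le (by simpa using (mem_ball_zero_iff.1 hw).le)
    have h8 := (h7.comp_tendsto hw0).trans (h4.pow 2)
    refine h8.trans ?_
    refine IsBigO.of_bound 1 ?_
    filter_upwards [Metric.ball_mem_nhds (0 : ℝ) one_pos] with T hT
    have hT1 : |T| < 1 := by simpa using hT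
    rw [← pow_mul, norm_pow, norm_pow, one_mul, Real.norm_eq_abs]
    exact pow_le_pow_of_le_one (abs_nonneg _) hT1.le (by norm_num)
  have h9 := h6.add h2
  refine IsBigO.trans (IsBigO.of_bound 1 (Filter.Eventually.of_forall fun T => ?_)) h9
  rw [one_mul]
  refine le_trans (le_of_eq ?_) (Complex.abs_re_le_norm _)
  rw [Real.norm_eq_abs]
  congr 1
  have e : Complex.exp ((T : ℂ) ^ 2 * M (0, (T : ℂ))) - 1 - (T : ℂ) ^ 2 * M (0, (T : ℂ)) +
      (T : ℂ) ^ 2 * (M (0, (T : ℂ)) - -β / 3) =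
      Complex.exp ((T : ℂ) ^ 2 * M (0, (T : ℂ))) - ((1 - β / 3 * T ^ 2 : ℝ) : ℂ) := by
    push_cast; ring
  rw [e, Complex.sub_re, Complex.ofReal_re, sigmaOfExponent, Complex.ofReal_zero]

end Sigma

/-! ### Stability and instability from the position of the nontrivial multiplier. -/

section Dichotomy

variable {a b T α A p k r R : ℝ} {x : ℝ → ℝ} {n : ℕ} {ν₀ : ℂ} {G : ℂ × ℂ → ℂ}

lemma IsMultiplier.sq {h : ℝ} {ν : ℂ} (hT : T = n * h) (hh : 0 < h)
    (hz : ∃ z, IsLinearizedSolution a b T x z ∧ (∀ t, z (t + h) = ν • z t) ∧ z 0 ≠ 0)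
    (hν : ν ≠ 0) : IsMultiplier a b T x (2 * h) (ν ^ 2) := by
  obtain ⟨z, hz, hfl, h0⟩ := hz
  have hT0 : 0 ≤ T := by rw [hT]; positivity
  refine isMultiplier_of_solution hz (pow_ne_zero 2 hν) (fun θ _ => ?_)
    ⟨0, ⟨by linarith, le_rfl⟩, h0⟩
  have e : 2 * h + θ = θ + h + h := by ring
  rw [e, hfl, hfl, smul_smul, pow_two]

/-- The rescaled initial acceleration is -(k + 1), which is negative because k > -1/2. -/
lemma IsDuffingOrbit.tangentCurve_zero_ne (hx : IsDuffingOrbit α A p x) (hr : r * A = 1)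
    (hkα : k = r ^ 2 * α) (hk : -(1 / 2) < k) : (tangentCurve α x 0).2 ≠ 0 := by
  change ((-α * x 0 - x 0 ^ 3 : ℝ) : ℂ) ≠ 0
  rw [Complex.ofReal_ne_zero, hx.initial]
  intro h
  have h1 : r ^ 3 * (-α * A - A ^ 3) = -(k + 1) := by
    rw [hkα]
    linear_combination (-(r ^ 2 * α) - (r * A) ^ 2 - r * A - 1) * hr
  rw [h, mul_zero] at h1
  linarith

/-- The half-period multipliers with bounded `‖(-ν)⁻ⁿ‖` correspond to the solutions of the
characteristic equation. -/
lemma IsDuffingOrbit.isMultiplier_iff (hx : IsDuffingOrbit α A p x) (hr : r * A = 1)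
    (hkα : k = r ^ 2 * α) (hk : -(1 / 2) < k) (hα : α = a + (-1) ^ n * b)
    (hT : T = n * (r * halfPeriod k)) (hh : 0 < r * halfPeriod k) (hG : HasDiscriminant G k)
    (hν₀ : ν₀ ≠ 0)
    (hroots : ∀ ν : ℂ, ν ≠ 0 → ((‖(ν ^ n)⁻¹‖ ≤ R ∧ ν + ν⁻¹ =
      2 + (r ^ 2 * ((-1) ^ n * b : ℝ) * ((ν ^ n)⁻¹ - 1)) *
        G (k, r ^ 2 * ((-1) ^ n * b : ℝ) * ((ν ^ n)⁻¹ - 1))) ↔ ν = 1 ∨ ν = ν₀)) (ν : ℂ) :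
    (IsMultiplier a b T x (r * halfPeriod k) ν ∧ ‖((-ν) ^ n)⁻¹‖ ≤ R) ↔ ν = -1 ∨ ν = -ν₀ := by
  constructor
  · rintro ⟨hm, hR⟩
    refine ((hroots (-ν) (neg_ne_zero.2 hm.1)).1
      ⟨hR, hx.characteristic hr hkα hk hα hT hh hG hm⟩).imp ?_ ?_
    · exact neg_eq_iff_eq_neg.1
    · exact neg_eq_iff_eq_neg.1
  · intro hν
    have h0 : ν ≠ 0 := by
      rcases hν with rfl | rfl
      · simp
      · exact neg_ne_zero.2 hν₀
    obtain ⟨hR, hchar⟩ := (hroots (-ν) (neg_ne_zero.2 h0)).2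
      (hν.imp neg_eq_iff_eq_neg.2 neg_eq_iff_eq_neg.2)
    obtain ⟨z, hz, hfl, hz0⟩ :=
      hx.exists_floquet_of_characteristic hr hkα hk hα hT hG h0 hchar
    have hT0 : 0 ≤ T := by rw [hT]; positivity
    exact ⟨isMultiplier_of_solution hz h0 (fun θ _ => by rw [add_comm, hfl])
      ⟨0, ⟨by linarith, le_rfl⟩, hz0⟩, hR⟩

/-- If the nontrivial half-period multiplier lies in the unit disk, the orbit is stable. -/
lemma IsDuffingOrbit.linearlyStable (hx : IsDuffingOrbit α A p x) (hb : b ≠ 0) (hn : n ≠ 0)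
    (hr : r * A = 1) (hkα : k = r ^ 2 * α) (hk : -(1 / 2) < k) (hα : α = a + (-1) ^ n * b)
    (hT : T = n * (r * halfPeriod k)) (hh : 0 < r * halfPeriod k) (hG : HasDiscriminant G k)
    (hR : 1 < R) (hν₀ : ‖ν₀‖ < 1)
    (hset : ∀ ν, (IsMultiplier a b T x (r * halfPeriod k) ν ∧ ‖((-ν) ^ n)⁻¹‖ ≤ R) →
      ν = -1 ∨ ν = -ν₀) :
    IsAlgebraicallySimple a b T x (2 * (r * halfPeriod k)) 1 ∧
      ∀ μ : ℂ, IsMultiplier a b T x (2 * (r * halfPeriod k)) μ → μ ≠ 1 → ‖μ‖ < 1 := by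
  -- A multiplier of modulus at least 1 satisfies ‖(-ρ)^(-n)‖ ≤ 1 < R and so belongs to the two
  -- known ones; the nontrivial one lies inside the disk.
  have hlarge : ∀ ρ, IsMultiplier a b T x (r * halfPeriod k) ρ → 1 ≤ ‖ρ‖ → ρ = -1 := by
    intro ρ hρ h1
    refine (hset ρ ⟨hρ, ?_⟩).resolve_right ?_
    · rw [norm_inv, norm_pow, norm_neg]
      exact (inv_le_one_of_one_le₀ (one_le_pow₀ h1)).trans hR.le
    · rintro rfl
      rw [norm_neg] at h1
      linarith
  have hxa := fun t => (hx.antiperiodic hr hkα hk t).1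
  have hxa' := fun t => (hx.antiperiodic hr hkα hk t).2
  have hX0 := hx.tangentCurve_zero_ne hr hkα hk
  refine ⟨hx.isAlgebraicallySimple hb hn hα hT hh hxa hxa' hX0 (fun h1 => ?_)
    (fun y y' hy hy' h => hx.antiperiodic_initial_eq_zero hr hkα hk hG hX0 hy hy' h),
    fun μ hμ hμ1 => ?_⟩
  · have := hlarge 1 h1 (by simp)
    norm_num at this
  · obtain ⟨ρ, rfl, hρ⟩ := hμ.exists_sq_eq hh.le (fun t => by rw [hxa, neg_sq])
    by_contra! h
    rw [norm_pow] at h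
    refine hμ1 ?_
    rw [hlarge ρ hρ ((one_le_sq_iff₀ (norm_nonneg _)).1 h), neg_one_sq]

/-- A half-period multiplier outside the closed unit disk makes the orbit unstable. -/
lemma IsDuffingOrbit.linearlyUnstable (hx : IsDuffingOrbit α A p x) (hr : r * A = 1)
    (hkα : k = r ^ 2 * α) (hk : -(1 / 2) < k) (hα : α = a + (-1) ^ n * b)
    (hT : T = n * (r * halfPeriod k)) (hh : 0 < r * halfPeriod k) (hG : HasDiscriminant G k)
    (hν₀ : 1 < ‖ν₀‖) (hm : IsMultiplier a b T x (r * halfPeriod k) (-ν₀)) :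
    ∃ μ : ℂ, IsMultiplier a b T x (2 * (r * halfPeriod k)) μ ∧ 1 < ‖μ‖ := by
  refine ⟨(-ν₀) ^ 2, IsMultiplier.sq hT hh (hx.exists_floquet_of_characteristic hr hkα hk hα hT hG
    hm.1 (hx.characteristic hr hkα hk hα hT hh hG hm)) hm.1, ?_⟩
  rw [norm_pow, norm_neg]
  exact one_lt_pow₀ hν₀ two_ne_zero

lemma not_linearlyUnstable_of_linearlyStable {a b T p : ℝ} {x : ℝ → ℝ}
    (h : LinearlyStable a b T p x) : ¬ LinearlyUnstable a b T p x := by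
  rintro ⟨μ, hμ, h1⟩
  by_cases e : μ = 1
  · rw [e, norm_one] at h1
    exact lt_irrefl _ h1
  · exact lt_asymm h1 (h.2 μ hμ e)

end Dichotomy

/-! ### Assembly of the theorem. -/

theorem theorem5p1 (a b : ℝ) (hb : b ≠ 0) (s : ℝ) (hs : s = 1 ∨ s = -1) :
    ∃ S : ℝ × ℝ → ℝ,
      ((fun T : ℝ => S (0, T) - (1 - (1 / 3) * s * b * T ^ 2)) =O[𝓝 0] fun T : ℝ => T ^ 3) ∧
      ∀ R : ℝ, 1 < R → ∃ T₀ : ℝ, 0 < T₀ ∧ ∃ δ₀ : ℝ, 0 < δ₀ ∧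
        AnalyticOnNhd ℝ S
          (Ioo (-√(δ₀ * T₀ ^ 2)) (√(δ₀ * T₀ ^ 2)) ×ˢ Ioo (-T₀) T₀) ∧
        ∀ (T : ℝ) (n : ℕ) (A ε : ℝ) (x : ℝ → ℝ),
          0 < T → T < T₀ → 0 < n → (-1 : ℝ) ^ n = s →
          IsDuffingOrbit (a + (-1) ^ n * b) A (2 * T / n) x →
          ε = (A ^ 2)⁻¹ → ε < δ₀ * T₀ ^ 2 →
            (∃ μ : ℂ, μ ≠ -1 ∧
              {ν : ℂ | IsMultiplier a b T x (T / n) ν ∧ ‖((-ν) ^ n)⁻¹‖ ≤ R} = {-1, μ} ∧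
              ((-μ) ^ n)⁻¹ = (S (√ε, T) : ℂ)) ∧
            (LinearlyStable a b T (2 * T / n) x ↔ (-1) ^ n * b < 0) ∧
            (LinearlyUnstable a b T (2 * T / n) x ↔ 0 < (-1) ^ n * b) := by
  obtain ⟨q, G, hq, hG, hq0, hG0, hk⟩ := exists_analytic_discriminant
  have hβ : s * b ≠ 0 := mul_ne_zero (by rcases hs with rfl | rfl <;> norm_num) hb
  obtain ⟨M, hM, hM0, hMroots⟩ := exists_multiplier_function (a + s * b) hβ hq hG hq0 hG0
  refine ⟨sigmaOfExponent M, (sigmaOfExponent_isBigO (β := s * b) hM hM0).congr_left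
    fun T => by ring, fun R hR => ?_⟩
  -- The parameter k = r²(a + s b) depends on n only through its parity, so one threshold serves all
  -- n.
  have hparam : ∀ᶠ d : ℝ in 𝓝[>] 0, ∀ r : ℝ, 0 < r → r < d → -(1 / 2) < r ^ 2 * (a + s * b) ∧
      q ((r ^ 2 * (a + s * b) : ℝ) : ℂ) = halfPeriod (r ^ 2 * (a + s * b)) ∧
      HasDiscriminant G (r ^ 2 * (a + s * b)) := by
    have h1 : Tendsto (fun r : ℝ => r ^ 2 * (a + s * b)) (𝓝 0) (𝓝 0) := by
      have : Continuous fun r : ℝ => r ^ 2 * (a + s * b) := by fun_prop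
      simpa using this.tendsto 0
    obtain ⟨δ, hδ, h2⟩ := Metric.eventually_nhds_iff.1
      ((h1.eventually (lt_mem_nhds (by norm_num : -(1 / 2 : ℝ) < 0))).and (h1.eventually hk))
    filter_upwards [mem_nhdsWithin_of_mem_nhds (gt_mem_nhds hδ)] with d hd r hr hrd
    exact h2 (by rw [Real.dist_eq, sub_zero, abs_of_pos hr]; exact hrd.trans hd)
  have hanalytic : ∀ᶠ d : ℝ in 𝓝[>] 0, ∀ r T : ℝ, |r| < d → |T| < d → AnalyticAt ℂ M (r, T) := by
    obtain ⟨δ, hδ, h2⟩ := Metric.eventually_nhds_iff.1 hM.analyticAt.eventually_analyticAt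
    filter_upwards [mem_nhdsWithin_of_mem_nhds (gt_mem_nhds hδ)] with d hd r T hr hT
    refine h2 ?_
    rw [Prod.dist_eq, max_lt_iff]
    simp only [dist_zero_right, Complex.norm_real, Real.norm_eq_abs]
    exact ⟨hr.trans hd, hT.trans hd⟩
  obtain ⟨d, ⟨⟨hroots, hparam⟩, hanalytic⟩, hd⟩ :=
    (((hMroots R hR).and hparam).and hanalytic |>.and self_mem_nhdsWithin).exists
  have hd : 0 < d := hd
  have hsq : √(1 * d ^ 2) = d := by rw [one_mul, Real.sqrt_sq hd.le]
  -- With T₀ = d and δ₀ = 1 the bound on √ε is again d, so the same radius controls r and T.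
  refine ⟨d, hd, 1, one_pos, ?_, ?_⟩
  · rw [hsq]
    rintro ⟨r, T⟩ ⟨hr, hT⟩
    exact analyticAt_sigmaOfExponent (hanalytic r T (abs_lt.2 hr) (abs_lt.2 hT))
  intro T n A ε x hT hTd hn hns hx hε hεd
  have hA := hx.amplitude_pos
  set r : ℝ := A⁻¹ with hr
  have hr0 : 0 < r := inv_pos.2 hA
  have hrA : r * A = 1 := inv_mul_cancel₀ hA.ne'
  have hεr : √ε = r := by rw [hε, ← inv_pow, Real.sqrt_sq hr0.le]
  have hrd : r < d := by
    rw [← hεr, ← hsq]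
    exact Real.sqrt_lt_sqrt (by rw [hε]; positivity) hεd
  obtain ⟨hk, hqk, hGk⟩ := hparam r hr0 hrd
  rw [← hns] at hk hqk hGk hroots
  set α : ℝ := a + (-1) ^ n * b with hα
  set k : ℝ := r ^ 2 * α with hkα
  have hh : 0 < r * halfPeriod k := mul_pos hr0 (halfPeriod_pos hk)
  have hp := hx.period_eq hrA hkα hk
  have hn0 : (n : ℝ) ≠ 0 := Nat.cast_ne_zero.2 hn.ne'
  have hTh : T / n = r * halfPeriod k := by
    rw [mul_div_assoc] at hp
    exact mul_left_cancel₀ two_ne_zero hp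
  have hTn : T = n * (r * halfPeriod k) := by rw [← hTh]; field_simp
  have hkc : ((k : ℝ) : ℂ) = (r : ℂ) ^ 2 * (α : ℂ) := by rw [hkα]; push_cast; ring
  obtain ⟨hsign, ν₀, hν₀, hν⟩ := hroots r T hr0 hrd hT hTd n (by
    rw [← hkc, hqk, hTn]; push_cast; ring)
  have hν₀0 : ν₀ ≠ 0 := by
    rintro rfl
    rw [zero_pow hn.ne', inv_zero] at hν₀
    exact Complex.exp_ne_zero _ hν₀.symm
  rw [← hkc] at hν
  have hset := hx.isMultiplier_iff hrA hkα hk hα hTn hh hGk hν₀0 hν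
  -- The sign of Re M, opposite to that of β, decides on which side of the unit circle ν₀ lies.
  have hnorm : (‖ν₀‖ ^ n)⁻¹ = Real.exp (T ^ 2 * (M (r, T)).re) := by
    rw [← norm_pow, ← norm_inv, hν₀, Complex.norm_exp]
    congr 1
    rw [← Complex.ofReal_pow, Complex.re_ofReal_mul]
  have hstable : (-1) ^ n * b < 0 → ‖ν₀‖ < 1 := by
    intro hneg
    have h1 : 0 < (M (r, T)).re := by
      by_contra! h
      nlinarith
    have h2 := Real.one_lt_exp_iff.2 (mul_pos (pow_pos hT 2) h1)
    rw [← hnorm] at h2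
    by_contra! h
    exact absurd h2 (inv_le_one_of_one_le₀ (one_le_pow₀ h)).not_gt
  have hunstable : 0 < (-1) ^ n * b → 1 < ‖ν₀‖ := by
    intro hpos
    have h1 : (M (r, T)).re < 0 := by
      by_contra! h
      nlinarith
    have h2 := Real.exp_lt_one_iff.2 (mul_neg_of_pos_of_neg (pow_pos hT 2) h1)
    rw [← hnorm] at h2
    by_contra! h
    exact absurd h2 (one_le_inv_iff₀.2 ⟨pow_pos (norm_pos_iff.2 hν₀0) n,
      pow_le_one₀ (norm_nonneg _) h⟩).not_gt
  have hβn : (-1) ^ n * b ≠ 0 := by rwa [hns]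
  have hν₀1 : ν₀ ≠ 1 := by
    rintro rfl
    rcases lt_or_gt_of_ne hβn with h | h
    · exact absurd (hstable h) (by simp)
    · exact absurd (hunstable h) (by simp)
  have hS : -1 ≠ -ν₀ := fun h => hν₀1 (neg_injective h).symm
  obtain ⟨hm, hmR⟩ := (hset (-ν₀)).2 (Or.inr rfl)
  -- The real coefficients make the two-element set of multipliers invariant under conjugation.
  -- Since -1 is real, the other element is real as well, so taking the real part in σ loses
  -- nothing.
  have hreal : star ν₀ = ν₀ := by
    refine neg_injective (((hset (-star ν₀)).1 ⟨?_, ?_⟩).resolve_left fun h => hν₀1 ?_)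
    · simpa using hm.conj
    · simpa only [neg_neg, norm_inv, norm_pow, norm_star] using hmR
    · simpa using congrArg star (neg_injective h)
  have hst : (-1) ^ n * b < 0 → LinearlyStable a b T (2 * T / n) x := fun h => by
    rw [hp]
    exact hx.linearlyStable hb hn.ne' hrA hkα hk hα hTn hh hGk hR (hstable h)
      fun ν => (hset ν).1
  have hun : 0 < (-1) ^ n * b → LinearlyUnstable a b T (2 * T / n) x := fun h => by
    rw [hp]
    exact hx.linearlyUnstable hrA hkα hk hα hTn hh hGk (hunstable h) hm
  refine ⟨⟨-ν₀, hS.symm, ?_, ?_⟩, ⟨fun h => ?_, hst⟩, ⟨fun h => ?_, hun⟩⟩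
  · rw [hTh]
    exact Set.ext fun ν => hset ν
  · rw [neg_neg, hεr, sigmaOfExponent, ← hν₀]
    refine (Complex.conj_eq_iff_re.1 ?_).symm
    change star ((ν₀ ^ n)⁻¹) = _
    rw [star_inv₀, star_pow, hreal]
  · by_contra hc
    exact not_linearlyUnstable_of_linearlyStable h (hun (lt_of_le_of_ne (not_lt.1 hc) hβn.symm))
  · by_contra hc
    exact not_linearlyUnstable_of_linearlyStable (hst (lt_of_le_of_ne (not_lt.1 hc) hβn)) h
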